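/- Let $m\ge 1$ and consider the scalar delay differential equation $$x'(t)=\sum_{j=1}^{m} p_j(t)\,x(t-\tau_j(t))\,e^{-a_j(t)x(t-\sigma_j(t))}-\delta(t)x(t),\qquad t\ge 0. \tag{1}$$ Write $p(t)=\sum_{j=1}^m p_j(t)$, $\tau=\max_{j}\max\{\sup_{t\ge0}\tau_j(t),\sup_{t\ge0}\sigma_j(t)\}$, $a^+=\max_j\sup_{t\ge0}a_j(t)$, $a^-=\min_j\inf_{t\ge0}a_j(t)$. A positive solution of (1) is a continuous function $x:[-\tau,\infty)\to\mathbb R$ with $x\ge 0$ on $[-\tau,0)$ and $x(0)>0$ that satisfies (1) for all $t\ge0$ (with the right derivative at $t=0$). Assume: (A0) $p_j,a_j,\delta:[0,\infty)\to(0,\infty)$ and $\sigma_j,\tau_j:[0,\infty)\to[0,\infty)$ are continuous, the $\sigma_j,\tau_j$ are bounded, and each $a_j$ is bounded above and below by positive constants ($1\le j\le m$); (A1) $\liminf_{t\to\infty}p(t)/\delta(t)>1$ and $\limsup_{t\to\infty}p(t)/\delta(t)<\infty$; (A2) $\limsup_{t\to\infty}\int_{t-\tau}^t p(s)\,ds<\infty$;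 (A3) $\int_0^\infty\delta(s)\,ds=\infty$. Put $\zeta^+=\max_{1\le j\le m}\limsup_{t\to\infty}\int_{t-\sigma_j(t)}^t\delta(s)\,ds$, and $$\alpha=\liminf_{t\to\infty}\frac{p(t)}{\delta(t)},\quad \gamma=\limsup_{t\to\infty}\frac{p(t)}{\delta(t)},\quad D=\limsup_{t\to\infty}\int_{t-\tau}^t\delta(s)\,ds,\quad P=\limsup_{t\to\infty}\int_{t-\tau}^t p(s)\,ds.$$ (a) Let $x^*$ be a positive solution of (1) for which there are $m^*,M^*>0$ and $T>0$ with $m^*\le x^*(t)\le M^*$ for all $t\ge T-\tau$ and $$a^+M^*\Big(\frac{M^*}{m^*}e^{\zeta^+}-1\Big)\le 1. \tag{A4}$$ Then $x^*$ attracts all positive solutions: $\lim_{t\to\infty}(x(t)-x^*(t))=0$ for every positive solution $x$ of (1). (b) If $$\frac{a^+}{a^-}\log\gamma\; e^{2(D+P)}\Big[\frac{a^+\log\gamma}{a^-\log\alpha}\,e^{4D+3P+\zeta^+}-1\Big]<1, \tag{A5}$$ then $\lim_{t\to\infty}(x_1(t)-x_2(t))=0$ for any two positive solutions $x_1,x_2$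 of (1). -/

import Mathlib

open Filter Set

/-- The coefficients and delays of the scalar delay differential equation
`x'(t) = ∑ j, p j t * x (t - τ j t) * exp (-(a j t) * x (t - σ j t)) - δ t * x t`, `t ≥ 0`,
with `m` pairs of delays. Only the values at times `t ≥ 0` matter. -/
structure NicholsonData (m : ℕ) where
  p : Fin m → ℝ → ℝ
  a : Fin m → ℝ → ℝ
  δ : ℝ → ℝ
  σ : Fin m → ℝ → ℝ
  τ : Fin m → ℝ → ℝ

namespace NicholsonData

variable {m : ℕ}

/-- `f^+ = sup_{t ≥ 0} f t`, for `f` bounded above on `[0, ∞)`. -/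
noncomputable def supPos (f : ℝ → ℝ) : ℝ := sSup (f '' Ici 0)

/-- `f^- = inf_{t ≥ 0} f t`, for `f` bounded below on `[0, ∞)`. -/
noncomputable def infPos (f : ℝ → ℝ) : ℝ := sInf (f '' Ici 0)

/-- `p(t) = ∑ j, p_j(t)`. -/
noncomputable def pTot (N : NicholsonData m) (t : ℝ) : ℝ := ∑ j, N.p j t

/-- `a^+ = max_j a_j^+`. -/
noncomputable def aPlus (N : NicholsonData m) : ℝ := ⨆ j, supPos (N.a j)

/-- `a^- = min_j a_j^-`. -/
noncomputable def aMinus (N : NicholsonData m) : ℝ := ⨅ j, infPos (N.a j)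

/-- The maximal delay `τ = max {τ_j^+, σ_j^+ : j}`. -/
noncomputable def maxDelay (N : NicholsonData m) : ℝ :=
  max (⨆ j, supPos (N.τ j)) (⨆ j, supPos (N.σ j))

/-- The general conditions (A0). -/
structure A0 (N : NicholsonData m) : Prop where
  p_cont : ∀ j, ContinuousOn (N.p j) (Ici 0)
  a_cont : ∀ j, ContinuousOn (N.a j) (Ici 0)
  δ_cont : ContinuousOn N.δ (Ici 0)
  σ_cont : ∀ j, ContinuousOn (N.σ j) (Ici 0)
  τ_cont : ∀ j, ContinuousOn (N.τ j) (Ici 0)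
  p_pos : ∀ j, ∀ t, 0 ≤ t → 0 < N.p j t
  δ_pos : ∀ t, 0 ≤ t → 0 < N.δ t
  σ_nonneg : ∀ j, ∀ t, 0 ≤ t → 0 ≤ N.σ j t
  τ_nonneg : ∀ j, ∀ t, 0 ≤ t → 0 ≤ N.τ j t
  σ_bdd : ∀ j, ∃ C, ∀ t, 0 ≤ t → N.σ j t ≤ C
  τ_bdd : ∀ j, ∃ C, ∀ t, 0 ≤ t → N.τ j t ≤ C
  a_bdd : ∀ j, ∃ c C, 0 < c ∧ ∀ t, 0 ≤ t → c ≤ N.a j t ∧ N.a j t ≤ C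

/-- `α = liminf_{t → ∞} p(t) / δ(t)`. -/
noncomputable def α (N : NicholsonData m) : ℝ := liminf (fun t => N.pTot t / N.δ t) atTop

/-- `γ = limsup_{t → ∞} p(t) / δ(t)`. -/
noncomputable def γ (N : NicholsonData m) : ℝ := limsup (fun t => N.pTot t / N.δ t) atTop

/-- `D = limsup_{t → ∞} ∫_{t-τ}^t δ`. -/
noncomputable def D (N : NicholsonData m) : ℝ :=
  limsup (fun t => ∫ s in (t - N.maxDelay)..t, N.δ s) atTop

/-- `P = limsup_{t → ∞} ∫_{t-τ}^t p`. -/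
noncomputable def P (N : NicholsonData m) : ℝ :=
  limsup (fun t => ∫ s in (t - N.maxDelay)..t, N.pTot s) atTop

/-- `ζ^+ = max_j limsup_{t → ∞} ∫_{t-σ_j(t)}^t δ`. -/
noncomputable def ζPlus (N : NicholsonData m) : ℝ :=
  ⨆ j, limsup (fun t => ∫ s in (t - N.σ j t)..t, N.δ s) atTop

/-- (A1): `liminf p/δ > 1` and `limsup p/δ < ∞` as `t → ∞`; the latter is expressed as
eventual boundedness from above, which also makes the real `liminf` and `limsup` genuine. -/
def A1 (N : NicholsonData m) : Prop :=
  1 < N.α ∧ IsBoundedUnder (· ≤ ·) atTop (fun t => N.pTot t / N.δ t)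

/-- (A2): `limsup_{t → ∞} ∫_{t-τ}^t p < ∞`. -/
def A2 (N : NicholsonData m) : Prop :=
  IsBoundedUnder (· ≤ ·) atTop (fun t => ∫ s in (t - N.maxDelay)..t, N.pTot s)

/-- (A3): `∫_0^∞ δ = ∞`. -/
def A3 (N : NicholsonData m) : Prop :=
  Tendsto (fun t => ∫ s in (0 : ℝ)..t, N.δ s) atTop atTop

/-- `x : [-τ, ∞) → ℝ` is a solution of the equation on `[0, ∞)` (with the one-sided derivative
at `0`) whose initial condition lies in
`C_0^+ = {φ ∈ C([-τ, 0]) : φ ≥ 0 on [-τ, 0), φ(0) > 0}`. These are the positive solutions. -/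
structure IsPositiveSolution (N : NicholsonData m) (x : ℝ → ℝ) : Prop where
  cont : ContinuousOn x (Ici (-N.maxDelay))
  init_nonneg : ∀ t ∈ Ico (-N.maxDelay) 0, 0 ≤ x t
  init_pos : 0 < x 0
  eqn : ∀ t, 0 ≤ t → HasDerivWithinAt x
    ((∑ j, N.p j t * x (t - N.τ j t) * Real.exp (-(N.a j t) * x (t - N.σ j t))) - N.δ t * x t)
    (Ici 0) t

/-- `xs` attracts all positive solutions. -/
def IsGlobalAttractor (N : NicholsonData m) (xs : ℝ → ℝ) : Prop :=
  ∀ x, N.IsPositiveSolution x → Tendsto (fun t => x t - xs t) atTop (nhds 0)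

/-- Condition (A4) on a function `xs`. -/
def A4 (N : NicholsonData m) (xs : ℝ → ℝ) : Prop :=
  ∃ ms Ms T : ℝ, 0 < ms ∧ 0 < Ms ∧ 0 < T ∧
    (∀ t, T - N.maxDelay ≤ t → ms ≤ xs t ∧ xs t ≤ Ms) ∧
    N.aPlus * Ms * (Ms / ms * Real.exp N.ζPlus - 1) ≤ 1

/-- Condition (A5). -/
def A5 (N : NicholsonData m) : Prop :=
  N.aPlus / N.aMinus * Real.log N.γ * Real.exp (2 * (N.D + N.P)) *
    ((N.aPlus * Real.log N.γ) / (N.aMinus * Real.log N.α) *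
      Real.exp (4 * N.D + 3 * N.P + N.ζPlus) - 1) < 1

end NicholsonData

/-! With `Δ' = δ`, the integrating factor turns a solution into `X = x * exp Δ`, whose derivative is
`exp Δ` times the birth term, hence nonnegative. Everything rests on comparing such an `X` with a
nondecreasing `Y → ∞`: if `X' ≤ K * Y'` whenever `X > B * Y`, with `K ≤ B`, then `limsup X / Y ≤ B`
(`eventually_le_mul_of_deriv_le`).

Permanence takes `Y = exp Δ`. Over one delay a solution falls at most by the factor `exp (-D)` and
grows at most by `exp (D + P)`, asymptotically. So a large `x t` forces every `x (t - σ)` to be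
large, the exponentials push the birth term below `δ` times the recent maximum, and `x` contracts;
small values are repelled in the same way.

Attractivity takes `Y = xs * exp Δ`. Let `1 + v` and `1 - u` be the upper and lower limits of `x /
xs` (deviations cut off at `0`), `c = a⁺ M*`, `ρ = (m*/M*) exp (-ζ⁺)`, `k = 1 - ρ`. When `x / xs` is
near its upper limit at `t`, either all values at `t - σ_j` exceed those of `xs`, and the birth term
of `x` is then too small to sustain the ratio, or some ratio at `t - σ_j` is about `1` or less, and
it can have risen only by a bounded amount since. This gives `1 + v ≤ k (1 + v) exp (c u) + ρ`, and
symmetrically `1 - u ≥ k (1 - u) exp (-c v) + ρ`. Under (A4), that is `k (1 + c) ≤ 1`, these force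
`u = v = 0` (`deviations_eq_zero`).

Part (b) follows since the permanence bounds of any solution satisfy (A4) when (A5) holds. -/

/-! ### Comparison of functions through their derivatives -/

theorem le_of_hasDerivAt_nonpos {f f' : ℝ → ℝ} {a b : ℝ} (hab : a ≤ b)
    (hc : ContinuousOn f (Icc a b)) (hd : ∀ t ∈ Ioo a b, HasDerivAt f (f' t) t)
    (hn : ∀ t ∈ Ioo a b, f' t ≤ 0) : f b ≤ f a := by
  have h : AntitoneOn f (Icc a b) := by
    apply antitoneOn_of_hasDerivWithinAt_nonpos (f' := f') (convex_Icc a b) hc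
    · rw [interior_Icc]
      exact fun t ht => (hd t ht).hasDerivWithinAt
    · rw [interior_Icc]
      exact hn
  exact h (left_mem_Icc.2 hab) (right_mem_Icc.2 hab) hab

theorem le_of_hasDerivAt_nonneg {f f' : ℝ → ℝ} {a b : ℝ} (hab : a ≤ b)
    (hc : ContinuousOn f (Icc a b)) (hd : ∀ t ∈ Ioo a b, HasDerivAt f (f' t) t)
    (hn : ∀ t ∈ Ioo a b, 0 ≤ f' t) : f a ≤ f b := by
  have := le_of_hasDerivAt_nonpos (f := fun t => - f t) (f' := fun t => - f' t) hab hc.neg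
    (fun t ht => (hd t ht).neg) (fun t ht => by linarith [hn t ht])
  linarith

/-- First crossing: a continuous function that starts negative and cannot reach `0` for the first
time stays negative. -/
theorem neg_of_no_first_crossing {h : ℝ → ℝ} {s t : ℝ} (hc : ContinuousOn h (Icc s t))
    (hs : h s < 0)
    (step : ∀ t₁ ∈ Ioc s t, (∀ r ∈ Ico s t₁, h r < 0) → h t₁ < 0) :
    ∀ r ∈ Icc s t, h r < 0 := by
  by_contra! hcon
  obtain ⟨r, hr, hr0⟩ := hcon
  set S : Set ℝ := Icc s t ∩ h ⁻¹' Ici 0 with hS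
  have hSc : IsClosed S := hc.preimage_isClosed_of_isClosed isClosed_Icc isClosed_Ici
  have hSn : S.Nonempty := ⟨r, hr, hr0⟩
  have hSb : BddBelow S := ⟨s, fun y hy => hy.1.1⟩
  have hm : sInf S ∈ S := hSc.csInf_mem hSn hSb
  have hne : s ≠ sInf S := by
    intro he
    have := hm.2
    rw [← he] at this
    exact absurd hs (not_lt.2 this)
  have hlt : s < sInf S := lt_of_le_of_ne hm.1.1 hne
  refine absurd (step _ ⟨hlt, hm.1.2⟩ ?_) (not_lt.2 hm.2)
  intro y hy
  by_contra! hy0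
  have : y ∈ S := ⟨⟨hy.1, hy.2.le.trans hm.1.2⟩, hy0⟩
  exact absurd (csInf_le hSb this) (not_le.2 hy.2)

/-- If `f` is nonincreasing wherever it is positive, it stays nonpositive. -/
theorem nonpos_of_nonpos_of_hasDerivAt {f f' : ℝ → ℝ} {s t : ℝ} (hst : s ≤ t)
    (hd : ∀ r ∈ Icc s t, HasDerivAt f (f' r) r) (hs : f s ≤ 0)
    (hn : ∀ r ∈ Icc s t, 0 < f r → f' r ≤ 0) : f t ≤ 0 := by
  have hc : ContinuousOn f (Icc s t) := fun r hr => (hd r hr).continuousAt.continuousWithinAt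
  by_contra! ht
  -- After its last nonpositive time `sSup S`, `f` is positive up to `t`, hence nonincreasing there.
  set S : Set ℝ := Icc s t ∩ f ⁻¹' Iic 0 with hS
  have hSc : IsClosed S := hc.preimage_isClosed_of_isClosed isClosed_Icc isClosed_Iic
  have hSn : S.Nonempty := ⟨s, ⟨le_rfl, hst⟩, hs⟩
  have hSb : BddAbove S := ⟨t, fun y hy => hy.1.2⟩
  have hm : sSup S ∈ S := hSc.csSup_mem hSn hSb
  have hsub : Icc (sSup S) t ⊆ Icc s t := Icc_subset_Icc_left hm.1.1
  have := le_of_hasDerivAt_nonpos hm.1.2 (hc.mono hsub)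
    (fun r hr => hd r (hsub (Ioo_subset_Icc_self hr))) (fun r hr => by
      refine hn r (hsub (Ioo_subset_Icc_self hr)) ?_
      by_contra! h0
      exact absurd (le_csSup hSb ⟨hsub (Ioo_subset_Icc_self hr), h0⟩) (not_le.2 hr.1))
  exact absurd (this.trans hm.2) (not_le.2 ht)

/-- Comparison: if `X' ≤ K Y'` wherever `X > B Y`, and `Y → ∞`, then `limsup X / Y ≤ B`. -/
theorem eventually_le_mul_of_deriv_le {X X' Y Y' : ℝ → ℝ} {T B B' K : ℝ}
    (hX : ∀ t, T ≤ t → HasDerivAt X (X' t) t) (hY : ∀ t, T ≤ t → HasDerivAt Y (Y' t) t)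
    (hY' : ∀ t, T ≤ t → 0 ≤ Y' t) (hYtop : Tendsto Y atTop atTop)
    (hKB : K ≤ B) (hBB : B < B')
    (H : ∀ t, T ≤ t → B * Y t < X t → X' t ≤ K * Y' t) :
    ∀ᶠ t in atTop, X t ≤ B' * Y t := by
  -- Once `X ≤ B * Y` holds it persists, because `K ≤ B`. If it never holds, `X - K * Y` is
  -- nonincreasing, and the resulting constant is absorbed by `(B' - K) * Y → ∞`.
  by_cases hcase : ∃ t₀, T ≤ t₀ ∧ X t₀ ≤ B * Y t₀
  · obtain ⟨t₀, hT, h0⟩ := hcase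
    filter_upwards [eventually_ge_atTop t₀, hYtop.eventually_ge_atTop 0] with t ht hYt
    have := nonpos_of_nonpos_of_hasDerivAt (f := fun t => X t - B * Y t)
      (f' := fun t => X' t - B * Y' t) ht
      (fun r hr => (hX r (hT.trans hr.1)).sub ((hY r (hT.trans hr.1)).const_mul B))
      (by linarith) (fun r hr hpos => by
        have h1 := H r (hT.trans hr.1) (by linarith)
        have h2 := mul_le_mul_of_nonneg_right hKB (hY' r (hT.trans hr.1))
        linarith)
    have h3 := mul_le_mul_of_nonneg_right hBB.le hYt
    linarith
  · push Not at hcase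
    have hbd : ∀ t, T ≤ t → X t - K * Y t ≤ X T - K * Y T := fun t ht =>
      le_of_hasDerivAt_nonpos (f := fun t => X t - K * Y t) (f' := fun t => X' t - K * Y' t) ht
        (fun r hr => ((hX r hr.1).sub ((hY r hr.1).const_mul K)).continuousAt.continuousWithinAt)
        (fun r hr => (hX r hr.1.le).sub ((hY r hr.1.le).const_mul K))
        (fun r hr => by linarith [H r hr.1.le (hcase r hr.1.le)])
    have hpos : 0 < B' - K := by linarith
    filter_upwards [eventually_ge_atTop T,
      hYtop.eventually_ge_atTop ((X T - K * Y T) / (B' - K))] with t ht hYt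
    rw [div_le_iff₀ hpos] at hYt
    linarith [hbd t ht]

/-- Contraction along delays: if `X' ≤ q K Y'` whenever `X > B Y` and `X ≤ K Y` on the last
delay interval, then `limsup X / Y ≤ B`. -/
theorem eventually_le_mul_of_delay_contraction {X X' Y Y' : ℝ → ℝ} {T B B' K₀ q r : ℝ}
    (hr : 0 ≤ r)
    (hX : ∀ t, T ≤ t → HasDerivAt X (X' t) t) (hY : ∀ t, T ≤ t → HasDerivAt Y (Y' t) t)
    (hY' : ∀ t, T ≤ t → 0 ≤ Y' t) (hYpos : ∀ t, T ≤ t → 0 < Y t)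
    (hYtop : Tendsto Y atTop atTop)
    (hBB : B < B') (hBK : B < K₀) (hq : ∀ K, B < K → K ≤ K₀ → q * K < K)
    (hinit : ∀ s ∈ Icc (T - r) T, X s < K₀ * Y s)
    (H : ∀ t, T ≤ t → ∀ K, B < K → K ≤ K₀ → (∀ s ∈ Icc (t - r) t, X s ≤ K * Y s) →
      B * Y t < X t → X' t ≤ q * K * Y' t) :
    ∀ᶠ t in atTop, X t ≤ B' * Y t := by
  have hXY : ∀ c t, T ≤ t → HasDerivAt (fun t => X t - c * Y t) (X' t - c * Y' t) t :=
    fun c t ht => (hX t ht).sub ((hY t ht).const_mul c)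
  -- Barrier: at a first contact with `K₀ * Y`, continuity gives `X > B * Y` just before, so `H`
  -- makes `X - K₀ * Y` nonincreasing there; being negative before, it cannot reach `0`.
  have hbd : ∀ t, T ≤ t → X t < K₀ * Y t := by
    intro t ht
    have := neg_of_no_first_crossing (h := fun t => X t - K₀ * Y t) (s := T) (t := t)
      (fun y hy => (hXY K₀ y hy.1).continuousAt.continuousWithinAt)
      (by linarith [hinit T ⟨by linarith, le_rfl⟩]) (fun t₁ ht₁ hlt => by
        by_contra! hge
        have hBt : 0 < X t₁ - B * Y t₁ := by
          have := mul_lt_mul_of_pos_right hBK (hYpos t₁ ht₁.1.le)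
          linarith
        have hev : ∀ᶠ y in nhds t₁, 0 < X y - B * Y y :=
          (hXY B t₁ ht₁.1.le).continuousAt.eventually (lt_mem_nhds hBt)
        obtain ⟨l, hl, hl'⟩ := exists_Ioc_subset_of_mem_nhds hev ⟨T, ht₁.1⟩
        obtain ⟨t₂, h2l, h2t⟩ := exists_between (max_lt hl ht₁.1)
        have hlt₂ : l < t₂ := (le_max_left _ _).trans_lt h2l
        have hTt₂ : T < t₂ := (le_max_right _ _).trans_lt h2l
        have := le_of_hasDerivAt_nonpos (f := fun t => X t - K₀ * Y t) h2t.le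
          (fun y hy => (hXY K₀ y (hTt₂.le.trans hy.1)).continuousAt.continuousWithinAt)
          (fun y hy => hXY K₀ y (hTt₂.le.trans hy.1.le)) (fun y hy => by
            have hTy : T ≤ y := hTt₂.le.trans hy.1.le
            have h1 := H y hTy K₀ hBK le_rfl (fun s hs => by
              rcases le_total s T with hsT | hsT
              · exact (hinit s ⟨by linarith [hs.1], hsT⟩).le
              · linarith [hlt s ⟨hsT, hs.2.trans_lt hy.2⟩])
              (by
                have h3 : 0 < X y - B * Y y := hl' ⟨hlt₂.trans hy.1, hy.2.le⟩
                linarith)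
            have h2 := mul_le_mul_of_nonneg_right (hq K₀ hBK le_rfl).le (hY' y hTy)
            linarith)
        linarith [hlt t₂ ⟨hTt₂.le, h2t⟩])
    linarith [this t ⟨ht, le_rfl⟩]
  rcases le_or_gt K₀ B' with hKB' | hKB'
  · filter_upwards [eventually_ge_atTop T] with t ht
    exact (hbd t ht).le.trans (mul_le_mul_of_nonneg_right hKB' (hYpos t ht).le)
  -- The infimum `K₁` of the eventual bounds must be `B'`: a bound `K` close enough to `K₁` has `q *
  -- K < K₁`, and the comparison without delay improves it to anything above `max B (q * K)`.
  set S : Set ℝ := {K | B' ≤ K ∧ K ≤ K₀ ∧ ∀ᶠ t in atTop, X t ≤ K * Y t} with hS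
  have hK₀S : K₀ ∈ S :=
    ⟨hKB'.le, le_rfl, (eventually_ge_atTop T).mono fun t ht => (hbd t ht).le⟩
  have hSb : BddBelow S := ⟨B', fun K hK => hK.1⟩
  set K₁ := sInf S with hK₁
  have hBK₁ : B' ≤ K₁ := le_csInf ⟨_, hK₀S⟩ fun K hK => hK.1
  have hK₁K₀ : K₁ ≤ K₀ := csInf_le hSb hK₀S
  have hq₁ : q * K₁ < K₁ := hq K₁ (hBB.trans_le hBK₁) hK₁K₀
  have hev : ∀ᶠ K in nhds K₁, q * K < K₁ :=
    (continuous_const.mul continuous_id).continuousAt.eventually (gt_mem_nhds hq₁)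
  obtain ⟨w, hw, hw'⟩ := exists_Ico_subset_of_mem_nhds hev ⟨K₁ + 1, by linarith⟩
  obtain ⟨K, hKS, hKw⟩ := exists_lt_of_csInf_lt ⟨_, hK₀S⟩ hw
  have hqK : q * K < K₁ := hw' ⟨csInf_le hSb hKS, hKw⟩
  obtain ⟨T₁, hT₁⟩ := eventually_atTop.1 hKS.2.2
  have key : ∀ B'', max B (q * K) < B'' → ∀ᶠ t in atTop, X t ≤ B'' * Y t := by
    intro B'' hB''
    have hTm : ∀ t, max T (T₁ + r) ≤ t → T ≤ t := fun t ht => (le_max_left _ _).trans ht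
    refine eventually_le_mul_of_deriv_le (T := max T (T₁ + r)) (K := q * K)
      (fun t ht => hX t (hTm t ht)) (fun t ht => hY t (hTm t ht)) (fun t ht => hY' t (hTm t ht))
      hYtop (le_max_right _ _) hB'' (fun t ht hlt => ?_)
    refine H t (hTm t ht) K (hBB.trans_le hKS.1) hKS.2.1 (fun s hs => hT₁ s ?_) ?_
    · linarith [hs.1, (le_max_right T (T₁ + r)).trans ht]
    · exact (mul_le_mul_of_nonneg_right (le_max_left _ _) (hYpos t (hTm t ht)).le).trans_lt hlt
  rcases hBK₁.eq_or_lt with he | hlt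
  · refine key B' (max_lt hBB ?_)
    rwa [he]
  · obtain ⟨c, hc1, hc2⟩ := exists_between (max_lt hlt hqK)
    have hcS : c ∈ S := ⟨(le_max_left _ _).trans hc1.le, hc2.le.trans hK₁K₀,
      key c (max_lt (hBB.trans_le ((le_max_left _ _).trans hc1.le)) ((le_max_right _ _).trans_lt hc1))⟩
    exact absurd (csInf_le hSb hcS) (not_le.2 hc2)

/-- A primitive of a function that is continuous on `[0, ∞)`. -/
theorem exists_primitive_of_continuousOn_Ici {f : ℝ → ℝ} (hf : ContinuousOn f (Ici 0)) :
    ∃ F : ℝ → ℝ, (∀ t, 0 ≤ t → HasDerivAt F (f t) t) ∧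
      ∀ s t, 0 ≤ s → 0 ≤ t → ∫ u in s..t, f u = F t - F s := by
  -- Freezing `f` at `f 0` on the negative axis gives a two-sided derivative at `0` too.
  have hg : Continuous fun t => f (max t 0) :=
    hf.comp_continuous (continuous_id.max continuous_const) fun t => mem_Ici.2 (le_max_right _ _)
  refine ⟨fun t => ∫ u in (0 : ℝ)..t, f (max u 0), fun t ht => ?_, fun s t hs ht => ?_⟩
  · have := (hg.integral_hasStrictDerivAt 0 t).hasDerivAt
    rwa [max_eq_left ht] at this
  · rw [intervalIntegral.integral_interval_sub_left (hg.intervalIntegrable _ _)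
      (hg.intervalIntegrable _ _)]
    refine intervalIntegral.integral_congr fun u hu => ?_
    have : 0 ≤ u := (le_min hs ht).trans hu.1
    simp only [max_eq_left this]

theorem primitive_mono {F f : ℝ → ℝ} (hF : ∀ t, 0 ≤ t → HasDerivAt F (f t) t)
    (hf : ∀ t, 0 ≤ t → 0 ≤ f t) {s t : ℝ} (hs : 0 ≤ s) (hst : s ≤ t) : F s ≤ F t :=
  le_of_hasDerivAt_nonneg hst
    (fun w hw => (hF w (hs.trans hw.1)).continuousAt.continuousWithinAt)
    (fun w hw => hF w (hs.trans hw.1.le)) (fun w hw => hf w (hs.trans hw.1.le))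

/-! ### The scalar inequalities behind attractivity -/

/-- Clearing denominators leaves `(w - 2) * exp w + w + 2 > 0`; the left side vanishes at `0` and
has derivative `1 - (1 - w) * exp w > 0`. -/
theorem one_div_sub_one_div_exp_sub_one_lt_half {w : ℝ} (hw : 0 < w) :
    1 / w - 1 / (Real.exp w - 1) < 1 / 2 := by
  have hder : ∀ t : ℝ, HasDerivAt (fun t => (t - 2) * Real.exp t + t + 2)
      (1 * Real.exp t + (t - 2) * Real.exp t + 1) t := fun t => by
    have := (((((hasDerivAt_id t).sub_const 2).mul (Real.hasDerivAt_exp t)).add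
      (hasDerivAt_id t)).add_const 2)
    simpa using this
  have hmono : StrictMonoOn (fun t : ℝ => (t - 2) * Real.exp t + t + 2) (Ici 0) := by
    refine strictMonoOn_of_deriv_pos (convex_Ici 0)
      (fun t _ => (hder t).continuousAt.continuousWithinAt) fun t ht => ?_
    rw [interior_Ici] at ht
    have ht : 0 < t := ht
    rw [(hder t).deriv]
    have h1 : (1 - t) < Real.exp (-t) := by
      have := Real.add_one_lt_exp (x := -t) (by linarith)
      linarith
    have h2 : (1 - t) * Real.exp t < 1 := by
      calc (1 - t) * Real.exp t < Real.exp (-t) * Real.exp t :=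
            mul_lt_mul_of_pos_right h1 (Real.exp_pos t)
        _ = 1 := by rw [← Real.exp_add]; simp
    linarith
  have h := hmono (mem_Ici.2 le_rfl) (mem_Ici.2 hw.le) hw
  simp only [Real.exp_zero] at h
  have he : 0 < Real.exp w - 1 := by linarith [Real.add_one_lt_exp hw.ne']
  rw [div_sub_div _ _ hw.ne' he.ne', div_lt_div_iff₀ (by positivity) two_pos]
  linarith

/-- The fixed-point argument behind attractivity: the two limit inequalities for the upper and the
lower deviation from `1` force both deviations to vanish. -/
theorem deviations_eq_zero {c k u v : ℝ} (hc : 0 < c) (hk : k * (1 + c) ≤ 1)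
    (hu : 0 ≤ u) (hv : 0 ≤ v)
    (hV : 0 < v → 1 + v ≤ k * ((1 + v) * Real.exp (c * u)) + (1 - k))
    (hU : 0 < u → k * ((1 - u) * Real.exp (-(c * v))) + (1 - k) ≤ 1 - u) :
    u = 0 ∧ v = 0 := by
  have hk1 : k < 1 := by
    by_contra! h
    nlinarith
  rcases hu.eq_or_lt with hu0 | hu0
  · refine ⟨hu0.symm, ?_⟩
    by_contra hv0
    have := hV (lt_of_le_of_ne hv (Ne.symm hv0))
    rw [← hu0] at this
    simp only [mul_zero, Real.exp_zero, mul_one] at this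
    have h2 : 0 < v * (1 - k) := mul_pos (lt_of_le_of_ne hv (Ne.symm hv0)) (by linarith)
    linarith
  rcases hv.eq_or_lt with hv0 | hv0
  · have := hU hu0
    rw [← hv0] at this
    simp only [mul_zero, neg_zero, Real.exp_zero, mul_one] at this
    have h2 : 0 < u * (1 - k) := mul_pos hu0 (by linarith)
    linarith
  exfalso
  have hcu : 0 < c * u := mul_pos hc hu0
  have hcv : 0 < c * v := mul_pos hc hv0
  set A := Real.exp (c * u) with hA
  set B := Real.exp (c * v) with hB
  have hA1 : 0 < A - 1 := by linarith [Real.add_one_lt_exp hcu.ne']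
  have hB1 : 0 < B - 1 := by linarith [Real.add_one_lt_exp hcv.ne']
  have hBinv : Real.exp (-(c * v)) = B⁻¹ := Real.exp_neg _
  have h1 : (1 + c) * v ≤ (1 + v) * A - 1 := by
    have h := hV hv0
    have h2 : 0 ≤ (1 + v) * A - 1 := by nlinarith
    nlinarith
  have h2 : (1 + c) * u ≤ 1 - (1 - u) * B⁻¹ := by
    have h := hU hu0
    rw [hBinv] at h
    have hBi : B⁻¹ ≤ 1 := inv_le_one_of_one_le₀ (by linarith)
    have hBi0 : 0 < B⁻¹ := by positivity
    have h2 : 0 ≤ 1 - (1 - u) * B⁻¹ := by nlinarith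
    nlinarith
  have h2' : (1 + c) * u * B ≤ B - (1 - u) := by
    have := mul_le_mul_of_nonneg_right h2 (by linarith : (0 : ℝ) ≤ B)
    have e : (1 - (1 - u) * B⁻¹) * B = B - (1 - u) := by
      rw [sub_mul, mul_assoc, inv_mul_cancel₀ (by linarith), one_mul, mul_one]
    linarith
  -- The terms `1 / c` cancel when `e1` and `e2` are added, leaving `1 ≤ g (c * u) + g (c * v)` with
  -- `g w = 1 / w - 1 / (exp w - 1)`, while each value of `g` is below `1 / 2`.
  have e1 : 1 / (A - 1) ≤ 1 / (c * v) + 1 / c := by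
    rw [div_add_div _ _ hcv.ne' hc.ne', div_le_div_iff₀ hA1 (by positivity)]
    nlinarith
  have e2 : 1 + 1 / (B - 1) ≤ 1 / (c * u) - 1 / c := by
    rw [div_sub_div _ _ hcu.ne' hc.ne', one_add_div hB1.ne', div_le_div_iff₀ hB1 (by positivity)]
    nlinarith
  have e3 := one_div_sub_one_div_exp_sub_one_lt_half hcu
  have e4 := one_div_sub_one_div_exp_sub_one_lt_half hcv
  rw [← hA] at e3
  rw [← hB] at e4
  linarith

/-! ### Coefficient bounds, positivity and growth over one delay -/

namespace NicholsonData

variable {m : ℕ}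

/-- For `m = 0` the total `p` vanishes, so `α = 0`, against `α > 1`. -/
theorem A1.nonempty {N : NicholsonData m} (h1 : N.A1) : Nonempty (Fin m) := by
  rcases m with _ | m
  · exfalso
    have h := h1.1
    have : N.α = 0 := by simp [α, pTot]
    linarith
  · exact ⟨0⟩

namespace A0

variable {N : NicholsonData m} (h0 : N.A0)
include h0

theorem τ_le {t : ℝ} (ht : 0 ≤ t) (j : Fin m) : N.τ j t ≤ N.maxDelay := by
  obtain ⟨C, hC⟩ := h0.τ_bdd j
  have hb : BddAbove (N.τ j '' Ici 0) := ⟨C, by rintro _ ⟨s, hs, rfl⟩; exact hC s hs⟩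
  exact (le_csSup hb ⟨t, ht, rfl⟩).trans
    ((le_ciSup (f := fun j => supPos (N.τ j)) (finite_range _).bddAbove j).trans (le_max_left _ _))

theorem σ_le {t : ℝ} (ht : 0 ≤ t) (j : Fin m) : N.σ j t ≤ N.maxDelay := by
  obtain ⟨C, hC⟩ := h0.σ_bdd j
  have hb : BddAbove (N.σ j '' Ici 0) := ⟨C, by rintro _ ⟨s, hs, rfl⟩; exact hC s hs⟩
  exact (le_csSup hb ⟨t, ht, rfl⟩).trans
    ((le_ciSup (f := fun j => supPos (N.σ j)) (finite_range _).bddAbove j).trans (le_max_right _ _))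

theorem a_le {t : ℝ} (ht : 0 ≤ t) (j : Fin m) : N.a j t ≤ N.aPlus := by
  obtain ⟨c, C, hc, hC⟩ := h0.a_bdd j
  have hb : BddAbove (N.a j '' Ici 0) := ⟨C, by rintro _ ⟨s, hs, rfl⟩; exact (hC s hs).2⟩
  exact (le_csSup hb ⟨t, ht, rfl⟩).trans
    (le_ciSup (f := fun j => supPos (N.a j)) (finite_range _).bddAbove j)

theorem le_a {t : ℝ} (ht : 0 ≤ t) (j : Fin m) : N.aMinus ≤ N.a j t := by
  obtain ⟨c, C, hc, hC⟩ := h0.a_bdd j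
  have hb : BddBelow (N.a j '' Ici 0) := ⟨c, by rintro _ ⟨s, hs, rfl⟩; exact (hC s hs).1⟩
  exact (ciInf_le (f := fun j => infPos (N.a j)) (finite_range _).bddBelow j).trans
    (csInf_le hb ⟨t, ht, rfl⟩)

theorem aMinus_pos [Nonempty (Fin m)] : 0 < N.aMinus := by
  obtain ⟨j, hj⟩ := exists_eq_ciInf_of_finite (f := fun j => infPos (N.a j))
  obtain ⟨c, C, hc, hC⟩ := h0.a_bdd j
  have : c ≤ infPos (N.a j) := le_csInf ⟨_, 0, mem_Ici.2 le_rfl, rfl⟩ (by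
    rintro _ ⟨s, hs, rfl⟩; exact (hC s hs).1)
  rw [aMinus, ← hj]
  exact hc.trans_le this

theorem aMinus_le_aPlus [Nonempty (Fin m)] : N.aMinus ≤ N.aPlus :=
  (h0.le_a le_rfl (Classical.arbitrary _)).trans (h0.a_le le_rfl (Classical.arbitrary _))

theorem aPlus_pos [Nonempty (Fin m)] : 0 < N.aPlus :=
  h0.aMinus_pos.trans_le h0.aMinus_le_aPlus

theorem maxDelay_nonneg [Nonempty (Fin m)] : 0 ≤ N.maxDelay :=
  (h0.τ_nonneg (Classical.arbitrary _) 0 le_rfl).trans (h0.τ_le le_rfl _)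

theorem pTot_cont : ContinuousOn N.pTot (Ici 0) :=
  continuousOn_finsetSum _ fun j _ => h0.p_cont j

theorem pTot_nonneg {t : ℝ} (ht : 0 ≤ t) : 0 ≤ N.pTot t :=
  Finset.sum_nonneg fun j _ => (h0.p_pos j t ht).le

theorem τ_mem {t : ℝ} (ht : 0 ≤ t) (j : Fin m) : t - N.τ j t ∈ Icc (t - N.maxDelay) t :=
  ⟨by linarith [h0.τ_le ht j], by linarith [h0.τ_nonneg j t ht]⟩

theorem σ_mem {t : ℝ} (ht : 0 ≤ t) (j : Fin m) : t - N.σ j t ∈ Icc (t - N.maxDelay) t :=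
  ⟨by linarith [h0.σ_le ht j], by linarith [h0.σ_nonneg j t ht]⟩

end A0

/-- The production term `∑ j, p_j(t) x(t - τ_j(t)) exp(-a_j(t) x(t - σ_j(t)))`. -/
noncomputable def birth (N : NicholsonData m) (x : ℝ → ℝ) (t : ℝ) : ℝ :=
  ∑ j, N.p j t * x (t - N.τ j t) * Real.exp (-(N.a j t) * x (t - N.σ j t))

theorem A0.birth_le {N : NicholsonData m} (h0 : N.A0) {x : ℝ → ℝ} {t K E : ℝ} (ht : 0 ≤ t)
    (hK : 0 ≤ K) (hx : ∀ s ∈ Icc (t - N.maxDelay) t, x s ≤ K)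
    (hE : ∀ j, Real.exp (-(N.a j t) * x (t - N.σ j t)) ≤ E) :
    N.birth x t ≤ N.pTot t * (K * E) := by
  rw [birth, pTot, Finset.sum_mul]
  refine Finset.sum_le_sum fun j _ => ?_
  rw [mul_assoc]
  exact mul_le_mul_of_nonneg_left
    (mul_le_mul (hx _ (h0.τ_mem ht j)) (hE j) (Real.exp_pos _).le hK) (h0.p_pos j t ht).le

theorem A0.le_birth {N : NicholsonData m} (h0 : N.A0) {x : ℝ → ℝ} {t K E : ℝ} (ht : 0 ≤ t)
    (hK : 0 ≤ K) (hEpos : 0 ≤ E) (hx : ∀ s ∈ Icc (t - N.maxDelay) t, K ≤ x s)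
    (hE : ∀ j, E ≤ Real.exp (-(N.a j t) * x (t - N.σ j t))) :
    N.pTot t * (K * E) ≤ N.birth x t := by
  rw [birth, pTot, Finset.sum_mul]
  refine Finset.sum_le_sum fun j _ => ?_
  rw [mul_assoc]
  exact mul_le_mul_of_nonneg_left
    (mul_le_mul (hx _ (h0.τ_mem ht j)) (hE j) hEpos (hK.trans (hx _ (h0.τ_mem ht j))))
    (h0.p_pos j t ht).le

namespace IsPositiveSolution

variable {N : NicholsonData m} {x : ℝ → ℝ}

theorem hasDerivAt (hx : N.IsPositiveSolution x) {t : ℝ} (ht : 0 < t) :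
    HasDerivAt x (N.birth x t - N.δ t * x t) t :=
  (hx.eqn t ht.le).hasDerivAt (Ici_mem_nhds ht)

theorem hasDerivAt_mul_exp (hx : N.IsPositiveSolution x) {Δ : ℝ → ℝ}
    (hΔ : ∀ t, 0 ≤ t → HasDerivAt Δ (N.δ t) t) {t : ℝ} (ht : 0 < t) :
    HasDerivAt (fun t => x t * Real.exp (Δ t)) (Real.exp (Δ t) * N.birth x t) t := by
  refine ((hx.hasDerivAt ht).mul (hΔ t ht.le).exp).congr_deriv ?_
  ring

theorem continuousOn_mul_exp [Nonempty (Fin m)] (h0 : N.A0) (hx : N.IsPositiveSolution x)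
    {Δ : ℝ → ℝ} (hΔ : ∀ t, 0 ≤ t → HasDerivAt Δ (N.δ t) t) :
    ContinuousOn (fun t => x t * Real.exp (Δ t)) (Ici 0) :=
  (hx.cont.mono (Ici_subset_Ici.2 (by linarith [h0.maxDelay_nonneg]))).mul
    (Real.continuous_exp.comp_continuousOn
      fun t ht => (hΔ t ht).continuousAt.continuousWithinAt)

theorem birth_nonneg_of_nonneg (h0 : N.A0) {t : ℝ} (ht : 0 ≤ t)
    (hx : ∀ s ∈ Icc (t - N.maxDelay) t, 0 ≤ x s) : 0 ≤ N.birth x t := by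
  have := h0.le_birth (E := 0) ht le_rfl le_rfl hx (fun j => (Real.exp_pos _).le)
  simpa using this

theorem pos [Nonempty (Fin m)] (h0 : N.A0) (hx : N.IsPositiveSolution x) {t : ℝ} (ht : 0 ≤ t) :
    0 < x t := by
  obtain ⟨Δ, hΔ, -⟩ := exists_primitive_of_continuousOn_Ici h0.δ_cont
  have hXc := hx.continuousOn_mul_exp h0 hΔ
  have hr := h0.maxDelay_nonneg
  have hcx : ContinuousOn (fun t => - x t) (Icc 0 t) :=
    (hx.cont.mono fun y hy => mem_Ici.2 (by linarith [hy.1])).neg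
  -- Up to a first zero of `x` the birth term is nonnegative, so `x * exp Δ` is nondecreasing and
  -- stays at least its positive value at `0`.
  have := neg_of_no_first_crossing hcx (by linarith [hx.init_pos]) (fun t₁ ht₁ hlt => by
    have h := le_of_hasDerivAt_nonneg ht₁.1.le (hXc.mono fun y hy => hy.1)
      (fun y hy => hx.hasDerivAt_mul_exp hΔ hy.1) (fun y hy => by
        refine mul_nonneg (Real.exp_pos _).le
          (birth_nonneg_of_nonneg h0 hy.1.le fun s hs => ?_)
        rcases lt_or_ge s 0 with hs0 | hs0
        · exact hx.init_nonneg s ⟨by linarith [hs.1, hy.1], hs0⟩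
        · linarith [hlt s ⟨hs0, hs.2.trans_lt hy.2⟩])
    have h2 : 0 < x t₁ * Real.exp (Δ t₁) :=
      (mul_pos hx.init_pos (Real.exp_pos _)).trans_le h
    linarith [pos_of_mul_pos_left h2 (Real.exp_pos _).le])
  linarith [this t ⟨ht, le_rfl⟩]

theorem nonneg [Nonempty (Fin m)] (h0 : N.A0) (hx : N.IsPositiveSolution x) {t : ℝ}
    (ht : -N.maxDelay ≤ t) : 0 ≤ x t := by
  rcases lt_or_ge t 0 with h | h
  · exact hx.init_nonneg t ⟨ht, h⟩
  · exact (hx.pos h0 h).le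

theorem birth_nonneg [Nonempty (Fin m)] (h0 : N.A0) (hx : N.IsPositiveSolution x) {t : ℝ}
    (ht : 0 ≤ t) : 0 ≤ N.birth x t :=
  birth_nonneg_of_nonneg h0 ht fun _ hs => hx.nonneg h0 (by linarith [hs.1])

theorem mul_exp_mono [Nonempty (Fin m)] (h0 : N.A0) (hx : N.IsPositiveSolution x) {Δ : ℝ → ℝ}
    (hΔ : ∀ t, 0 ≤ t → HasDerivAt Δ (N.δ t) t) {s t : ℝ} (hs : 0 ≤ s) (hst : s ≤ t) :
    x s * Real.exp (Δ s) ≤ x t * Real.exp (Δ t) :=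
  le_of_hasDerivAt_nonneg hst ((hx.continuousOn_mul_exp h0 hΔ).mono fun _ hy => hs.trans hy.1)
    (fun _ hy => hx.hasDerivAt_mul_exp hΔ (hs.trans_lt hy.1))
    (fun _ hy => mul_nonneg (Real.exp_pos _).le (hx.birth_nonneg h0 (hs.trans hy.1.le)))

/-- Backward bound: a solution decays at most at the rate `δ`. -/
theorem le_mul_exp_of_le [Nonempty (Fin m)] (h0 : N.A0) (hx : N.IsPositiveSolution x) {Δ : ℝ → ℝ}
    (hΔ : ∀ t, 0 ≤ t → HasDerivAt Δ (N.δ t) t) {s t d : ℝ} (hs : 0 ≤ s) (hst : s ≤ t)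
    (hd : Δ t - Δ s ≤ d) : x s ≤ x t * Real.exp d := by
  have h := hx.mul_exp_mono h0 hΔ hs hst
  have hxt := hx.pos h0 (hs.trans hst)
  have h2 : x t * Real.exp (Δ t) ≤ x t * Real.exp d * Real.exp (Δ s) := by
    rw [mul_assoc, ← Real.exp_add]
    exact mul_le_mul_of_nonneg_left (Real.exp_le_exp.2 (by linarith)) hxt.le
  exact le_of_mul_le_mul_right (h.trans h2) (Real.exp_pos _)

/-- Forward bound: over one delay interval a solution grows at most by the factor
`exp (D + P)`. -/
theorem le_mul_exp_add [Nonempty (Fin m)] (h0 : N.A0) (hx : N.IsPositiveSolution x)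
    {Δ Q : ℝ → ℝ} (hΔ : ∀ t, 0 ≤ t → HasDerivAt Δ (N.δ t) t)
    (hQ : ∀ t, 0 ≤ t → HasDerivAt Q (N.pTot t) t) {s t d q : ℝ} (hs : N.maxDelay ≤ s)
    (hs0 : 0 < s) (hst : s ≤ t) (hd0 : 0 < d) (hd : Δ s - Δ (s - N.maxDelay) ≤ d)
    (hq : Q t - Q s ≤ q) : x t ≤ x s * Real.exp (d + q) := by
  -- The backward bound puts `x ≤ c` on the delay interval before `s`. From `s` on, `c * exp (Q - Q
  -- s)` is a barrier: it grows at the rate `p` and its present value bounds the whole history,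
  -- while the exponential factors are at most `1`.
  have hr := h0.maxDelay_nonneg
  set c := x s * Real.exp d with hcdef
  have hxs := hx.pos h0 hs0.le
  have hc : 0 < c := mul_pos hxs (Real.exp_pos _)
  have hΔmono : ∀ y z, 0 ≤ y → y ≤ z → Δ y ≤ Δ z := fun y z =>
    primitive_mono hΔ fun w hw => (h0.δ_pos w hw).le
  have hQmono : ∀ y z, 0 ≤ y → y ≤ z → Q y ≤ Q z := fun y z =>
    primitive_mono hQ fun w hw => h0.pTot_nonneg hw
  have hback : ∀ y ∈ Icc (s - N.maxDelay) s, x y ≤ c := fun y hy =>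
    hx.le_mul_exp_of_le h0 hΔ (by linarith [hy.1]) hy.2
      (by linarith [hΔmono (s - N.maxDelay) y (by linarith) hy.1])
  have hder : ∀ y, s ≤ y → HasDerivAt (fun y => x y - c * Real.exp (Q y - Q s))
      (N.birth x y - N.δ y * x y - c * (Real.exp (Q y - Q s) * N.pTot y)) y := fun y hy =>
    (hx.hasDerivAt (hs0.trans_le hy)).sub
      ((((hQ y (hs0.le.trans hy)).sub_const (Q s)).exp).const_mul c)
  -- Strictness at the start is what `0 < d` provides.
  have hh0 : x s - c * Real.exp (Q s - Q s) < 0 := by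
    have : 1 < Real.exp d := Real.one_lt_exp_iff.2 hd0
    rw [sub_self, Real.exp_zero, mul_one, hcdef]
    nlinarith
  have key := neg_of_no_first_crossing (h := fun y => x y - c * Real.exp (Q y - Q s))
    (s := s) (t := t) (fun y hy => (hder y hy.1).continuousAt.continuousWithinAt) hh0
    (fun t₁ ht₁ hlt => by
      refine lt_of_le_of_lt ?_ hh0
      refine le_of_hasDerivAt_nonpos (f := fun y => x y - c * Real.exp (Q y - Q s)) ht₁.1.le
        (fun y hy => (hder y hy.1).continuousAt.continuousWithinAt)
        (fun y hy => hder y hy.1.le) (fun y hy => ?_)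
      have hy0 : 0 ≤ y := hs0.le.trans hy.1.le
      have hb := h0.birth_le (x := x) (K := c * Real.exp (Q y - Q s)) (E := 1) hy0
        (by positivity) (fun z hz => by
          rcases le_total z s with hzs | hzs
          · have h1 := hback z ⟨by linarith [hz.1, hy.1], hzs⟩
            have h2 : 1 ≤ Real.exp (Q y - Q s) :=
              Real.one_le_exp (by linarith [hQmono s y hs0.le hy.1.le])
            nlinarith
          · have h1 := hlt z ⟨hzs, hz.2.trans_lt hy.2⟩
            have h2 : c * Real.exp (Q z - Q s) ≤ c * Real.exp (Q y - Q s) :=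
              mul_le_mul_of_nonneg_left (Real.exp_le_exp.2
                (by linarith [hQmono z y (hs0.le.trans hzs) hz.2])) hc.le
            linarith)
        (fun j => by
          refine Real.exp_le_one_iff.2 ?_
          have h1 : 0 ≤ x (y - N.σ j y) :=
            hx.nonneg h0 (by linarith [(h0.σ_mem hy0 j).1])
          obtain ⟨a, C, ha, haC⟩ := h0.a_bdd j
          have := mul_nonneg (ha.le.trans (haC y hy0).1) h1
          linarith)
      have := mul_nonneg (h0.δ_pos y hy0).le (hx.pos h0 hy0).le
      have e : N.pTot y * (c * Real.exp (Q y - Q s) * 1)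
        = c * (Real.exp (Q y - Q s) * N.pTot y) := by ring
      linarith)
  have h1 := key t ⟨hst, le_rfl⟩
  have h2 : c * Real.exp (Q t - Q s) ≤ c * Real.exp q :=
    mul_le_mul_of_nonneg_left (Real.exp_le_exp.2 hq) hc.le
  rw [Real.exp_add, ← mul_assoc]
  linarith

end IsPositiveSolution

end NicholsonData

/-! ### Asymptotic estimates and permanence -/

namespace NicholsonData

variable {m : ℕ} {N : NicholsonData m}

theorem A3.tendsto_primitive (h3 : N.A3) {Δ : ℝ → ℝ}
    (hint : ∀ s t, 0 ≤ s → 0 ≤ t → ∫ u in s..t, N.δ u = Δ t - Δ s) :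
    Tendsto Δ atTop atTop := by
  have := tendsto_atTop_add_const_right _ (Δ 0) h3
  refine this.congr' ?_
  filter_upwards [eventually_ge_atTop 0] with t ht
  rw [hint 0 t le_rfl ht]
  ring

section Asymptotics

variable (h0 : N.A0)
include h0

theorem A0.ratio_bddBelow : IsBoundedUnder (· ≥ ·) atTop (fun t => N.pTot t / N.δ t) :=
  ⟨0, eventually_map.2 <| (eventually_ge_atTop 0).mono fun t ht =>
    div_nonneg (h0.pTot_nonneg ht) (h0.δ_pos t ht).le⟩

theorem A0.α_le_γ (h1 : N.A1) : N.α ≤ N.γ :=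
  liminf_le_limsup h1.2 h0.ratio_bddBelow

theorem A0.eventually_pTot_le (h1 : N.A1) {c : ℝ} (hc : N.γ < c) :
    ∀ᶠ t in atTop, N.pTot t ≤ c * N.δ t := by
  filter_upwards [eventually_lt_of_limsup_lt hc h1.2, eventually_ge_atTop 0] with t ht ht0
  rw [div_lt_iff₀ (h0.δ_pos t ht0)] at ht
  exact ht.le

theorem A0.eventually_le_pTot {c : ℝ} (hc : c < N.α) :
    ∀ᶠ t in atTop, c * N.δ t ≤ N.pTot t := by
  filter_upwards [eventually_lt_of_lt_liminf hc h0.ratio_bddBelow, eventually_ge_atTop 0]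
    with t ht ht0
  rw [lt_div_iff₀ (h0.δ_pos t ht0)] at ht
  exact ht.le

variable [Nonempty (Fin m)]

/-- Since `α > 1`, eventually `δ ≤ p`, so (A2) controls `δ` as well. -/
theorem A0.isBoundedUnder_integral_δ (h1 : N.A1) (h2 : N.A2) :
    IsBoundedUnder (· ≤ ·) atTop (fun t => ∫ s in (t - N.maxDelay)..t, N.δ s) := by
  obtain ⟨T, hT⟩ := eventually_atTop.1 (h0.eventually_le_pTot h1.1)
  obtain ⟨C, hC⟩ := h2
  refine ⟨C, ?_⟩
  rw [eventually_map] at hC ⊢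
  have hr := h0.maxDelay_nonneg
  filter_upwards [hC, eventually_ge_atTop (max T 0 + N.maxDelay)] with t ht htT
  have hsub : ∀ s ∈ Icc (t - N.maxDelay) t, max T 0 ≤ s := fun s hs => by linarith [hs.1]
  have hsub0 : uIcc (t - N.maxDelay) t ⊆ Ici 0 := by
    rw [uIcc_of_le (by linarith)]
    exact fun s hs => (le_max_right _ _).trans (hsub s hs)
  refine le_trans ?_ ht
  refine intervalIntegral.integral_mono_on (by linarith)
    (h0.δ_cont.mono hsub0).intervalIntegrable (h0.pTot_cont.mono hsub0).intervalIntegrable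
    fun s hs => ?_
  have := hT s ((le_max_left _ _).trans (hsub s hs))
  linarith

theorem A0.integral_δ_nonneg :
    ∀ᶠ t in atTop, 0 ≤ ∫ s in (t - N.maxDelay)..t, N.δ s := by
  have hr := h0.maxDelay_nonneg
  filter_upwards [eventually_ge_atTop N.maxDelay] with t ht
  exact intervalIntegral.integral_nonneg (by linarith)
    fun s hs => (h0.δ_pos s (by linarith [hs.1])).le

theorem A0.D_nonneg (h1 : N.A1) (h2 : N.A2) : 0 ≤ N.D :=
  le_limsup_of_frequently_le h0.integral_δ_nonneg.frequently
    (h0.isBoundedUnder_integral_δ h1 h2)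

theorem A0.P_nonneg (h2 : N.A2) : 0 ≤ N.P := by
  refine le_limsup_of_frequently_le (Eventually.frequently ?_) h2
  have hr := h0.maxDelay_nonneg
  filter_upwards [eventually_ge_atTop N.maxDelay] with t ht
  exact intervalIntegral.integral_nonneg (by linarith)
    fun s hs => h0.pTot_nonneg (by linarith [hs.1])

theorem A0.eventually_δ_le (h1 : N.A1) (h2 : N.A2) {Δ : ℝ → ℝ}
    (hint : ∀ s t, 0 ≤ s → 0 ≤ t → ∫ u in s..t, N.δ u = Δ t - Δ s) {d : ℝ} (hd : N.D < d) :
    ∀ᶠ t in atTop, Δ t - Δ (t - N.maxDelay) ≤ d := by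
  have hr := h0.maxDelay_nonneg
  filter_upwards [eventually_lt_of_limsup_lt hd (h0.isBoundedUnder_integral_δ h1 h2),
    eventually_ge_atTop N.maxDelay] with t ht htr
  rw [hint _ _ (by linarith) (by linarith)] at ht
  exact ht.le

theorem A0.eventually_p_le (h2 : N.A2) {Q : ℝ → ℝ}
    (hint : ∀ s t, 0 ≤ s → 0 ≤ t → ∫ u in s..t, N.pTot u = Q t - Q s) {q : ℝ} (hq : N.P < q) :
    ∀ᶠ t in atTop, Q t - Q (t - N.maxDelay) ≤ q := by
  have hr := h0.maxDelay_nonneg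
  filter_upwards [eventually_lt_of_limsup_lt hq h2,
    eventually_ge_atTop N.maxDelay] with t ht htr
  rw [hint _ _ (by linarith) (by linarith)] at ht
  exact ht.le

theorem A0.eventually_ζ_le (h1 : N.A1) (h2 : N.A2) {Δ : ℝ → ℝ}
    (hΔ : ∀ t, 0 ≤ t → HasDerivAt Δ (N.δ t) t)
    (hint : ∀ s t, 0 ≤ s → 0 ≤ t → ∫ u in s..t, N.δ u = Δ t - Δ s) {z : ℝ} (hz : N.ζPlus < z) :
    ∀ᶠ t in atTop, ∀ j, Δ t - Δ (t - N.σ j t) ≤ z := by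
  have hr := h0.maxDelay_nonneg
  refine eventually_all.2 fun j => ?_
  have hlt : limsup (fun t => ∫ s in (t - N.σ j t)..t, N.δ s) atTop < z :=
    (le_ciSup (f := fun j => limsup (fun t => ∫ s in (t - N.σ j t)..t, N.δ s) atTop)
      (finite_range _).bddAbove j).trans_lt hz
  -- Without boundedness the real `limsup` carries no information; it is inherited from the integral
  -- over the full delay.
  have hb : IsBoundedUnder (· ≤ ·) atTop (fun t => ∫ s in (t - N.σ j t)..t, N.δ s) := by
    refine (h0.isBoundedUnder_integral_δ h1 h2).mono_le ?_
    filter_upwards [eventually_ge_atTop N.maxDelay] with t ht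
    have ht0 : 0 ≤ t := hr.trans ht
    have hs := h0.σ_mem ht0 j
    rw [hint _ _ (by linarith [hs.1]) ht0, hint _ _ (by linarith) ht0]
    linarith [primitive_mono hΔ (fun w hw => (h0.δ_pos w hw).le) (sub_nonneg.2 ht) hs.1]
  filter_upwards [eventually_lt_of_limsup_lt hlt hb, eventually_ge_atTop N.maxDelay] with t ht htr
  have ht0 : 0 ≤ t := hr.trans htr
  rw [hint _ _ (by linarith [(h0.σ_mem ht0 j).1]) ht0] at ht
  exact ht.le

end Asymptotics

namespace IsPositiveSolution

variable [Nonempty (Fin m)] {x : ℝ → ℝ}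

/-- Asymptotic upper bound for positive solutions. -/
theorem eventually_le (h0 : N.A0) (h1 : N.A1) (h2 : N.A2) (h3 : N.A3)
    (hx : N.IsPositiveSolution x) {L d q : ℝ} (hL : Real.log N.γ < L) (hd : N.D < d)
    (hq : N.P < q) : ∀ᶠ t in atTop, x t ≤ L / N.aMinus * Real.exp (d + q) := by
  obtain ⟨Δ, hΔ, hΔint⟩ := exists_primitive_of_continuousOn_Ici h0.δ_cont
  obtain ⟨Q, hQ, hQint⟩ := exists_primitive_of_continuousOn_Ici h0.pTot_cont
  have hr := h0.maxDelay_nonneg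
  have ha := h0.aMinus_pos
  have hγ : 1 < N.γ := h1.1.trans_le (h0.α_le_γ h1)
  have hlogγ : 0 < Real.log N.γ := Real.log_pos hγ
  -- The choice `log γ < L' < L` and `γ < g < exp L'` makes the contraction factor `g * exp (-L')`
  -- less than `1`.
  obtain ⟨L', hL1, hL2⟩ := exists_between hL
  have hγL : N.γ < Real.exp L' := (Real.log_lt_iff_lt_exp (by linarith)).1 hL1
  obtain ⟨g, hg1, hg2⟩ := exists_between hγL
  have hL'0 : 0 < L' := hlogγ.trans hL1
  set B := L' / N.aMinus * Real.exp (d + q) with hB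
  have hB0 : 0 < B := by positivity
  obtain ⟨T, hT⟩ := eventually_atTop.1 ((h0.eventually_pTot_le h1 hg1).and
    ((h0.eventually_δ_le h1 h2 hΔint hd).and (h0.eventually_p_le h2 hQint hq)))
  -- Two delays of room: the estimates are also used on the delay interval that ends at `t - σ`.
  set T₀ := max T 0 + 2 * N.maxDelay + 1 with hT₀
  have hT0 : 0 ≤ max T 0 := le_max_right _ _
  obtain ⟨C, hC⟩ := (isCompact_Icc.image_of_continuousOn
    (hx.cont.mono (fun y hy => mem_Ici.2 (by linarith [hy.1]) :
      Icc (T₀ - N.maxDelay) T₀ ⊆ Ici (-N.maxDelay)))).bddAbove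
  have key := eventually_le_mul_of_delay_contraction
    (X := fun t => x t * Real.exp (Δ t)) (Y := fun t => Real.exp (Δ t))
    (X' := fun t => Real.exp (Δ t) * N.birth x t) (Y' := fun t => Real.exp (Δ t) * N.δ t)
    (T := T₀) (B := B) (B' := L / N.aMinus * Real.exp (d + q)) (K₀ := max B C + 1)
    (q := g * Real.exp (-L')) hr
    (fun t ht => hx.hasDerivAt_mul_exp hΔ (by linarith))
    (fun t ht => (hΔ t (by linarith)).exp)
    (fun t ht => mul_nonneg (Real.exp_pos _).le (h0.δ_pos t (by linarith)).le)
    (fun t _ => Real.exp_pos _)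
    (Real.tendsto_exp_atTop.comp (h3.tendsto_primitive hΔint))
    (by rw [hB]; gcongr) (by linarith [le_max_left B C])
    (fun K hK _ => by
      have hK0 : 0 < K := hB0.trans hK
      have : g * Real.exp (-L') < 1 := by
        rw [Real.exp_neg, ← div_eq_mul_inv, div_lt_one (Real.exp_pos _)]
        exact hg2
      nlinarith)
    (fun s hs => by
      have := hC ⟨s, hs, rfl⟩
      exact mul_lt_mul_of_pos_right (by linarith [le_max_right B C]) (Real.exp_pos _))
    (fun t ht K hK _ hbd hlt => by
      have hK0 : 0 < K := hB0.trans hK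
      have ht0 : 0 ≤ t := by linarith
      have hTt : T ≤ t := by linarith [le_max_left T 0]
      have hxB : B < x t := lt_of_mul_lt_mul_right hlt (Real.exp_pos _).le
      -- The factor `exp (d + q)` in `B` pays for the growth between `t - σ` and `t`, leaving `a * x
      -- (t - σ) > L'`.
      have hexp : ∀ j, Real.exp (-(N.a j t) * x (t - N.σ j t)) ≤ Real.exp (-L') := fun j => by
        have hσ := h0.σ_mem ht0 j
        have hTs : T ≤ t - N.σ j t := by linarith [le_max_left T 0, hσ.1]
        have hgrow := hx.le_mul_exp_add h0 hΔ hQ (s := t - N.σ j t) (t := t)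
          (by linarith [hσ.1]) (by linarith [hσ.1]) hσ.2 ((h0.D_nonneg h1 h2).trans_lt hd)
          (hT _ hTs).2.1 (q := q) (by
            have := primitive_mono hQ (fun w hw => h0.pTot_nonneg hw) (by linarith) hσ.1
            linarith [(hT t hTt).2.2])
        have h5 : L' / N.aMinus < x (t - N.σ j t) :=
          lt_of_mul_lt_mul_right (hxB.trans_le hgrow) (Real.exp_pos _).le
        rw [div_lt_iff₀ ha] at h5
        have h6 : 0 ≤ x (t - N.σ j t) := hx.nonneg h0 (by linarith [hσ.1])
        have h7 := mul_le_mul_of_nonneg_right (h0.le_a ht0 j) h6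
        exact Real.exp_le_exp.2 (by linarith)
      have hb := h0.birth_le ht0 hK0.le
        (fun s hs => le_of_mul_le_mul_right (hbd s hs) (Real.exp_pos _)) hexp
      have hp := (hT t hTt).1
      have h5 : N.pTot t * (K * Real.exp (-L')) ≤ g * N.δ t * (K * Real.exp (-L')) := by
        gcongr
      have h6 := mul_le_mul_of_nonneg_left (hb.trans h5) (Real.exp_pos (Δ t)).le
      refine h6.trans (le_of_eq (by ring)))
  filter_upwards [key] with t ht
  exact le_of_mul_le_mul_right ht (Real.exp_pos _)

/-- Asymptotic lower bound for positive solutions. -/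
theorem eventually_ge (h0 : N.A0) (h1 : N.A1) (h2 : N.A2) (h3 : N.A3)
    (hx : N.IsPositiveSolution x) {l d : ℝ} (hl0 : 0 < l) (hl : l < Real.log N.α) (hd : N.D < d) :
    ∀ᶠ t in atTop, l / N.aPlus * Real.exp (-d) ≤ x t := by
  obtain ⟨Δ, hΔ, hΔint⟩ := exists_primitive_of_continuousOn_Ici h0.δ_cont
  have hr := h0.maxDelay_nonneg
  have ha := h0.aPlus_pos
  obtain ⟨l', hl1, hl2⟩ := exists_between hl
  have hαl : Real.exp l' < N.α := (Real.lt_log_iff_exp_lt (by linarith [h1.1])).1 hl2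
  obtain ⟨g, hg1, hg2⟩ := exists_between hαl
  have hl'0 : 0 < l' := hl0.trans hl1
  set b := l' / N.aPlus * Real.exp (-d) with hb
  have hb0 : 0 < b := by positivity
  obtain ⟨T, hT⟩ := eventually_atTop.1 ((h0.eventually_le_pTot hg2).and
    (h0.eventually_δ_le h1 h2 hΔint hd))
  set T₀ := max T 0 + 2 * N.maxDelay + 1 with hT₀
  have hT0 : 0 ≤ max T 0 := le_max_right _ _
  obtain ⟨y₀, hy₀, hmin⟩ := isCompact_Icc.exists_isMinOn
    (nonempty_Icc.2 (by linarith : T₀ - N.maxDelay ≤ T₀))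
    (hx.cont.mono (fun y hy => mem_Ici.2 (by linarith [hy.1]) :
      Icc (T₀ - N.maxDelay) T₀ ⊆ Ici (-N.maxDelay)))
  have hxy₀ : 0 < x y₀ := hx.pos h0 (by linarith [hy₀.1])
  set k₀ := min b (x y₀) / 2 with hk₀
  have hk₀pos : 0 < k₀ := half_pos (lt_min hb0 hxy₀)
  -- Applied to `-x * exp Δ`, so the constants `K` are negative; there `q > 1` is what gives `q * K
  -- < K`.
  have key := eventually_le_mul_of_delay_contraction
    (X := fun t => -(x t * Real.exp (Δ t))) (Y := fun t => Real.exp (Δ t))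
    (X' := fun t => -(Real.exp (Δ t) * N.birth x t)) (Y' := fun t => Real.exp (Δ t) * N.δ t)
    (T := T₀) (B := -b) (B' := -(l / N.aPlus * Real.exp (-d))) (K₀ := -k₀)
    (q := g * Real.exp (-l')) hr
    (fun t ht => (hx.hasDerivAt_mul_exp hΔ (by linarith)).neg)
    (fun t ht => (hΔ t (by linarith)).exp)
    (fun t ht => mul_nonneg (Real.exp_pos _).le (h0.δ_pos t (by linarith)).le)
    (fun t _ => Real.exp_pos _)
    (Real.tendsto_exp_atTop.comp (h3.tendsto_primitive hΔint))
    (by rw [hb]; gcongr) (by linarith [min_le_left b (x y₀)])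
    (fun K _ hK => by
      have : 1 < g * Real.exp (-l') := by
        rw [Real.exp_neg, ← div_eq_mul_inv, one_lt_div (Real.exp_pos _)]
        exact hg1
      nlinarith)
    (fun s hs => by
      have h4 : x y₀ ≤ x s := hmin hs
      have h5 : k₀ < x s := by linarith [min_le_right b (x y₀)]
      have := mul_lt_mul_of_pos_right h5 (Real.exp_pos (Δ s))
      linarith)
    (fun t ht K _ hK hbd hlt => by
      have hK0 : 0 ≤ -K := by linarith
      have ht0 : 0 ≤ t := by linarith
      have hTt : T ≤ t := by linarith [le_max_left T 0]
      have hxB : x t < b :=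
        lt_of_mul_lt_mul_right (by linarith : x t * Real.exp (Δ t) < b * Real.exp (Δ t))
          (Real.exp_pos _).le
      have hexp : ∀ j, Real.exp (-l') ≤ Real.exp (-(N.a j t) * x (t - N.σ j t)) := fun j => by
        have hσ := h0.σ_mem ht0 j
        have hback := hx.le_mul_exp_of_le h0 hΔ (s := t - N.σ j t) (t := t) (d := d)
          (by linarith [hσ.1]) hσ.2 (by
            have := primitive_mono hΔ (fun w hw => (h0.δ_pos w hw).le) (by linarith) hσ.1
            linarith [(hT t hTt).2])
        have h5 : x (t - N.σ j t) ≤ l' / N.aPlus := by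
          refine hback.trans ((mul_le_mul_of_nonneg_right hxB.le (Real.exp_pos d).le).trans ?_)
          rw [hb, mul_assoc, ← Real.exp_add]
          simp
        rw [le_div_iff₀ ha] at h5
        have h6 : 0 ≤ x (t - N.σ j t) := hx.nonneg h0 (by linarith [hσ.1])
        have h7 := mul_le_mul_of_nonneg_right (h0.a_le ht0 j) h6
        exact Real.exp_le_exp.2 (by linarith)
      have hbirth := h0.le_birth ht0 hK0 (Real.exp_pos _).le
        (fun s hs => le_of_mul_le_mul_right
          (by linarith [hbd s hs] : -K * Real.exp (Δ s) ≤ x s * Real.exp (Δ s)) (Real.exp_pos _))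
        hexp
      have hp := (hT t hTt).1
      have h5 : g * N.δ t * (-K * Real.exp (-l')) ≤ N.pTot t * (-K * Real.exp (-l')) := by
        gcongr
      have h6 := mul_le_mul_of_nonneg_left (h5.trans hbirth) (Real.exp_pos (Δ t)).le
      have e : Real.exp (Δ t) * (g * N.δ t * (-K * Real.exp (-l')))
        = -(g * Real.exp (-l') * K * (Real.exp (Δ t) * N.δ t)) := by ring
      linarith)
  filter_upwards [key] with t ht
  exact le_of_mul_le_mul_right (by linarith) (Real.exp_pos (Δ t))

end IsPositiveSolution
end NicholsonData

/-! ### Attractivity through the ratio of two solutions -/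

theorem le_of_forall_pos_lt_le_of_continuous {f : ℝ → ℝ} (hf : Continuous f) {a e : ℝ}
    (he : 0 < e) (h : ∀ ε, 0 < ε → ε < e → a ≤ f ε) : a ≤ f 0 := by
  have ht : Tendsto f (nhdsWithin 0 (Ioi 0)) (nhds (f 0)) :=
    hf.continuousAt.tendsto.mono_left nhdsWithin_le_nhds
  refine ge_of_tendsto ht ?_
  filter_upwards [Ioo_mem_nhdsGT he] with ε hε
  exact h ε hε.1 hε.2

namespace NicholsonData

variable {m : ℕ} {N : NicholsonData m}

/-- Used with `e > 0` as a crude bound on the growth of the ratio, and with `e < 0` as a gain when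
`x` exceeds `y` at the times `t - σ_j`. -/
theorem A0.birth_le_mul_birth (h0 : N.A0) {x y : ℝ → ℝ} {t K e : ℝ} (ht : 0 ≤ t) (hK : 0 ≤ K)
    (hy : ∀ s ∈ Icc (t - N.maxDelay) t, 0 ≤ y s)
    (hxy : ∀ s ∈ Icc (t - N.maxDelay) t, x s ≤ K * y s)
    (he : ∀ j, N.a j t * (y (t - N.σ j t) - x (t - N.σ j t)) ≤ e) :
    N.birth x t ≤ K * Real.exp e * N.birth y t := by
  rw [birth, birth, Finset.mul_sum]
  refine Finset.sum_le_sum fun j _ => ?_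
  have h1 : Real.exp (-(N.a j t) * x (t - N.σ j t))
      ≤ Real.exp e * Real.exp (-(N.a j t) * y (t - N.σ j t)) := by
    rw [← Real.exp_add]
    exact Real.exp_le_exp.2 (by linarith [he j])
  have h2 := mul_le_mul (hxy _ (h0.τ_mem ht j)) h1 (Real.exp_pos _).le
    (mul_nonneg hK (hy _ (h0.τ_mem ht j)))
  have h3 := mul_le_mul_of_nonneg_left h2 (h0.p_pos j t ht).le
  linarith

theorem A0.mul_birth_le_birth (h0 : N.A0) {x y : ℝ → ℝ} {t K e : ℝ} (ht : 0 ≤ t) (hK : 0 ≤ K)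
    (hy : ∀ s ∈ Icc (t - N.maxDelay) t, 0 ≤ y s)
    (hxy : ∀ s ∈ Icc (t - N.maxDelay) t, K * y s ≤ x s)
    (he : ∀ j, e ≤ N.a j t * (y (t - N.σ j t) - x (t - N.σ j t))) :
    K * Real.exp e * N.birth y t ≤ N.birth x t := by
  rw [birth, birth, Finset.mul_sum]
  refine Finset.sum_le_sum fun j _ => ?_
  have h1 : Real.exp e * Real.exp (-(N.a j t) * y (t - N.σ j t))
      ≤ Real.exp (-(N.a j t) * x (t - N.σ j t)) := by
    rw [← Real.exp_add]
    exact Real.exp_le_exp.2 (by linarith [he j])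
  have h0y := mul_nonneg hK (hy _ (h0.τ_mem ht j))
  have h2 := mul_le_mul (hxy _ (h0.τ_mem ht j)) h1 (by positivity)
    (h0y.trans (hxy _ (h0.τ_mem ht j)))
  have h3 := mul_le_mul_of_nonneg_left h2 (h0.p_pos j t ht).le
  linarith

namespace IsPositiveSolution

variable [Nonempty (Fin m)] {x xs : ℝ → ℝ}

theorem tendsto_mul_exp {ms : ℝ} {Δ : ℝ → ℝ} (hms : 0 < ms) (hΔ : Tendsto Δ atTop atTop)
    (hb : ∀ᶠ t in atTop, ms ≤ xs t) :
    Tendsto (fun t => xs t * Real.exp (Δ t)) atTop atTop := by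
  refine tendsto_atTop_mono' atTop ?_ ((Real.tendsto_exp_atTop.comp hΔ).const_mul_atTop hms)
  filter_upwards [hb] with t ht
  exact mul_le_mul_of_nonneg_right ht (Real.exp_pos _).le

/-- Source of `ρ`: over the delay `σ_j`, `xs * exp Δ` retains at least this fraction of its later
value. -/
theorem mul_exp_ge_of_bounds {ms Ms z : ℝ} {Δ : ℝ → ℝ} {s t : ℝ} (hms : 0 < ms) (hMs : 0 < Ms)
    (hs : ms ≤ xs s) (ht : xs t ≤ Ms) (hz : Δ t - Δ s ≤ z) :
    ms / Ms * Real.exp (-z) * (xs t * Real.exp (Δ t)) ≤ xs s * Real.exp (Δ s) := by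
  calc ms / Ms * Real.exp (-z) * (xs t * Real.exp (Δ t))
      ≤ ms / Ms * Real.exp (-z) * (Ms * Real.exp (Δ t)) := by gcongr
    _ = ms * Real.exp (Δ t - z) := by
        rw [sub_eq_add_neg, Real.exp_add]
        field_simp
    _ ≤ xs s * Real.exp (Δ s) :=
        mul_le_mul hs (Real.exp_le_exp.2 (by linarith)) (Real.exp_pos _).le (hms.le.trans hs)

/-- If `1 + v` with `v > 0` is the upper limit of `x / xs` and `1 - u` bounds the lower limit, then
`1 + v` satisfies a limit inequality. -/
theorem upper_limit_inequality (h0 : N.A0) (h1 : N.A1) (h2 : N.A2) (h3 : N.A3)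
    (hx : N.IsPositiveSolution x) (hxs : N.IsPositiveSolution xs) {ms Ms u v : ℝ}
    (hms : 0 < ms) (hb : ∀ᶠ t in atTop, ms ≤ xs t ∧ xs t ≤ Ms) (hu : 0 ≤ u) (hv : 0 < v)
    (hlo : ∀ ε, 0 < ε → ∀ᶠ t in atTop, (1 - u - ε) * xs t ≤ x t)
    (hup : ∀ ε, 0 < ε → ∀ᶠ t in atTop, x t ≤ (1 + v + ε) * xs t)
    (hleast : ∀ B, (∀ᶠ t in atTop, x t ≤ B * xs t) → 1 + v ≤ B) :
    1 + v ≤ (1 - ms / Ms * Real.exp (-N.ζPlus)) * ((1 + v) * Real.exp (N.aPlus * Ms * u))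
      + (1 - (1 - ms / Ms * Real.exp (-N.ζPlus))) := by
  obtain ⟨Δ, hΔ, hΔint⟩ := exists_primitive_of_continuousOn_Ici h0.δ_cont
  have hr := h0.maxDelay_nonneg
  have ha := h0.aMinus_pos
  have haP := h0.aPlus_pos
  have hMs : 0 < Ms := by
    obtain ⟨t, ht⟩ := hb.exists
    exact hms.trans_le (ht.1.trans ht.2)
  -- The first entry of the maximum covers a ratio at most `1 + η` at some `t - σ_j`; the second,
  -- ratios above `1 + η` at all of them.
  have main : ∀ η, 0 < η → η < v → ∀ ε, 0 < ε → ε < 1 → 1 + v ≤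
      max ((1 + v + ε) * Real.exp (N.aPlus * Ms * (u + ε))
        - ((1 + v + ε) * Real.exp (N.aPlus * Ms * (u + ε)) - 1 - η)
          * (ms / Ms * Real.exp (-(N.ζPlus + ε))))
        ((1 + v + ε) * Real.exp (-(N.aMinus * ms * η))) := by
    intro η hη hηv ε hε _
    set K := (1 + v + ε) * Real.exp (N.aPlus * Ms * (u + ε)) with hK
    set ρ := ms / Ms * Real.exp (-(N.ζPlus + ε)) with hρ
    set E := Real.exp (-(N.aMinus * ms * η)) with hE
    have hK1 : 1 + η ≤ K := by
      have : 1 ≤ Real.exp (N.aPlus * Ms * (u + ε)) := Real.one_le_exp (by positivity)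
      nlinarith
    obtain ⟨T, hT⟩ := eventually_atTop.1 ((hb.and ((hlo ε hε).and (hup ε hε))).and
      (h0.eventually_ζ_le h1 h2 hΔ hΔint (lt_add_of_pos_right N.ζPlus hε)))
    set T₀ := max T 0 + 2 * N.maxDelay + 1 with hT₀
    have hT0 : 0 ≤ max T 0 := le_max_right _ _
    have hTT : T ≤ max T 0 := le_max_left _ _
    refine le_of_forall_gt_imp_ge_of_dense fun B' hB' => hleast B' ?_
    have key := eventually_le_mul_of_deriv_le
      (X := fun t => x t * Real.exp (Δ t)) (Y := fun t => xs t * Real.exp (Δ t))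
      (X' := fun t => Real.exp (Δ t) * N.birth x t) (Y' := fun t => Real.exp (Δ t) * N.birth xs t)
      (T := T₀) (B := max (K - (K - 1 - η) * ρ) ((1 + v + ε) * E)) (B' := B')
      (K := (1 + v + ε) * E)
      (fun t ht => hx.hasDerivAt_mul_exp hΔ (by linarith))
      (fun t ht => hxs.hasDerivAt_mul_exp hΔ (by linarith))
      (fun t ht => mul_nonneg (Real.exp_pos _).le (hxs.birth_nonneg h0 (by linarith)))
      (tendsto_mul_exp hms (h3.tendsto_primitive hΔint) (hb.mono fun _ h => h.1))
      (le_max_right _ _) hB'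
      (fun t ht hlt => by
        have ht0 : 0 ≤ t := by linarith
        have hxs0 : ∀ s, T ≤ s → 0 ≤ xs s := fun s hs => hms.le.trans (hT s hs).1.1.1
        -- Otherwise, `X - K * Y` being nonincreasing on `[t - σ_j, t]`, `X t ≤ K * Y t - (K - 1 -
        -- η) * Y (t - σ_j) ≤ (K - (K - 1 - η) * ρ) * Y t`, against `hlt`.
        have hfar : ∀ j, (1 + η) * xs (t - N.σ j t) < x (t - N.σ j t) := by
          intro j
          by_contra! hcon
          have hσ := h0.σ_mem ht0 j
          have hmono := le_of_hasDerivAt_nonpos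
            (f := fun t => x t * Real.exp (Δ t) - K * (xs t * Real.exp (Δ t)))
            (f' := fun t => Real.exp (Δ t) * N.birth x t - K * (Real.exp (Δ t) * N.birth xs t))
            hσ.2
            (fun y hy => ((hx.hasDerivAt_mul_exp hΔ (by linarith [hy.1, hσ.1])).sub
              ((hxs.hasDerivAt_mul_exp hΔ (by linarith [hy.1, hσ.1])).const_mul K)
                ).continuousAt.continuousWithinAt)
            (fun y hy => (hx.hasDerivAt_mul_exp hΔ (by linarith [hy.1, hσ.1])).sub
              ((hxs.hasDerivAt_mul_exp hΔ (by linarith [hy.1, hσ.1])).const_mul K))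
            (fun y hy => by
              have hTy : T + N.maxDelay ≤ y := by linarith [hy.1, hσ.1]
              have hy0 : 0 ≤ y := by linarith [hy.1, hσ.1]
              have hbirth := h0.birth_le_mul_birth (x := x) (y := xs) (K := 1 + v + ε)
                (e := N.aPlus * Ms * (u + ε)) hy0 (by linarith)
                (fun s hs => hxs0 s (by linarith [hs.1]))
                (fun s hs => (hT s (by linarith [hs.1])).1.2.2) (fun i => by
                  have hi := hT (y - N.σ i y) (by linarith [(h0.σ_mem hy0 i).1])
                  have h6 : xs (y - N.σ i y) - x (y - N.σ i y) ≤ (u + ε) * Ms := by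
                    have := mul_le_mul_of_nonneg_left hi.1.1.2 (by linarith : 0 ≤ u + ε)
                    linarith [hi.1.2.1]
                  calc _ ≤ N.a i y * ((u + ε) * Ms) :=
                        mul_le_mul_of_nonneg_left h6 (ha.le.trans (h0.le_a hy0 i))
                    _ ≤ N.aPlus * ((u + ε) * Ms) :=
                        mul_le_mul_of_nonneg_right (h0.a_le hy0 i) (by positivity)
                    _ = _ := by ring)
              have := mul_le_mul_of_nonneg_left hbirth (Real.exp_pos (Δ y)).le
              linarith)
          have hYs := mul_exp_ge_of_bounds (Δ := Δ) hms hMs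
            (hT (t - N.σ j t) (by linarith [hσ.1])).1.1.1 (hT t (by linarith)).1.1.2
            ((hT t (by linarith)).2 j)
          have h7 := mul_le_mul_of_nonneg_left hYs (by linarith : 0 ≤ K - 1 - η)
          have h8 := mul_le_mul_of_nonneg_right hcon (Real.exp_pos (Δ (t - N.σ j t))).le
          have h9 := mul_le_mul_of_nonneg_right
            (le_max_left (K - (K - 1 - η) * ρ) ((1 + v + ε) * E))
            (mul_nonneg (hxs0 t (by linarith)) (Real.exp_pos (Δ t)).le)
          rw [← hρ] at h7
          linarith
        have hbirth := h0.birth_le_mul_birth (x := x) (y := xs) (K := 1 + v + ε)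
          (e := -(N.aMinus * ms * η)) ht0 (by linarith)
          (fun s hs => hxs0 s (by linarith [hs.1]))
          (fun s hs => (hT s (by linarith [hs.1])).1.2.2) (fun i => by
            have hi := hT (t - N.σ i t) (by linarith [(h0.σ_mem ht0 i).1])
            have h6 : η * ms ≤ x (t - N.σ i t) - xs (t - N.σ i t) := by
              have := mul_le_mul_of_nonneg_left hi.1.1.1 hη.le
              linarith [hfar i]
            have h7 := mul_le_mul (h0.le_a ht0 i) h6 (by positivity)
              (ha.le.trans (h0.le_a ht0 i))
            linarith)
        have := mul_le_mul_of_nonneg_left hbirth (Real.exp_pos (Δ t)).le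
        linarith)
    filter_upwards [key] with t ht
    exact le_of_mul_le_mul_right (by linarith) (Real.exp_pos (Δ t))
  have step : ∀ η, 0 < η → η < v → 1 + v ≤
      (1 + v) * Real.exp (N.aPlus * Ms * u) - ((1 + v) * Real.exp (N.aPlus * Ms * u) - 1 - η)
          * (ms / Ms * Real.exp (-N.ζPlus)) := by
    intro η hη hηv
    have h4 := le_of_forall_pos_lt_le_of_continuous (by fun_prop) one_pos (main η hη hηv)
    simp only [add_zero] at h4
    -- At `ε = 0` the second entry is `1 + v` times a factor less than `1`, so only the first
    -- remains.
    rcases le_max_iff.1 h4 with h5 | h5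
    · exact h5
    · exfalso
      have : Real.exp (-(N.aMinus * ms * η)) < 1 := by
        rw [Real.exp_lt_one_iff]
        have : 0 < N.aMinus * ms * η := by positivity
        linarith
      nlinarith
  have h6 := le_of_forall_pos_lt_le_of_continuous (by fun_prop) hv step
  linarith

/-- If `1 - u` with `0 < u < 1` is the lower limit of `x / xs` and `1 + v` bounds the upper limit,
then `1 - u` satisfies a limit inequality. -/
theorem lower_limit_inequality (h0 : N.A0) (h1 : N.A1) (h2 : N.A2) (h3 : N.A3)
    (hx : N.IsPositiveSolution x) (hxs : N.IsPositiveSolution xs) {ms Ms u v : ℝ}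
    (hms : 0 < ms) (hb : ∀ᶠ t in atTop, ms ≤ xs t ∧ xs t ≤ Ms) (hu : 0 < u) (hu1 : u < 1)
    (hv : 0 ≤ v)
    (hlo : ∀ ε, 0 < ε → ∀ᶠ t in atTop, (1 - u - ε) * xs t ≤ x t)
    (hup : ∀ ε, 0 < ε → ∀ᶠ t in atTop, x t ≤ (1 + v + ε) * xs t)
    (hgreatest : ∀ B, (∀ᶠ t in atTop, B * xs t ≤ x t) → B ≤ 1 - u) :
    (1 - ms / Ms * Real.exp (-N.ζPlus)) * ((1 - u) * Real.exp (-(N.aPlus * Ms * v)))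
      + (1 - (1 - ms / Ms * Real.exp (-N.ζPlus))) ≤ 1 - u := by
  obtain ⟨Δ, hΔ, hΔint⟩ := exists_primitive_of_continuousOn_Ici h0.δ_cont
  have hr := h0.maxDelay_nonneg
  have ha := h0.aMinus_pos
  have haP := h0.aPlus_pos
  have hMs : 0 < Ms := by
    obtain ⟨t, ht⟩ := hb.exists
    exact hms.trans_le (ht.1.trans ht.2)
  -- Mirror image of the upper estimate, negated to fit the limit lemma; `ε < 1 - u` keeps the
  -- multiplier `1 - u - ε` positive.
  have main : ∀ η, 0 < η → η < u → ∀ ε, 0 < ε → ε < 1 - u → -(1 - u) ≤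
      -min ((1 - u - ε) * Real.exp (-(N.aPlus * Ms * (v + ε)))
        + (1 - η - (1 - u - ε) * Real.exp (-(N.aPlus * Ms * (v + ε))))
          * (ms / Ms * Real.exp (-(N.ζPlus + ε))))
        ((1 - u - ε) * Real.exp (N.aMinus * ms * η)) := by
    intro η hη hηu ε hε hεu
    rw [neg_le_neg_iff]
    set K := (1 - u - ε) * Real.exp (-(N.aPlus * Ms * (v + ε))) with hK
    set ρ := ms / Ms * Real.exp (-(N.ζPlus + ε)) with hρ
    set E := Real.exp (N.aMinus * ms * η) with hE
    have hK1 : K ≤ 1 - η := by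
      have : Real.exp (-(N.aPlus * Ms * (v + ε))) ≤ 1 := Real.exp_le_one_iff.2 (by
        have : 0 ≤ N.aPlus * Ms * (v + ε) := by positivity
        linarith)
      nlinarith
    obtain ⟨T, hT⟩ := eventually_atTop.1 ((hb.and ((hlo ε hε).and (hup ε hε))).and
      (h0.eventually_ζ_le h1 h2 hΔ hΔint (lt_add_of_pos_right N.ζPlus hε)))
    set T₀ := max T 0 + 2 * N.maxDelay + 1 with hT₀
    have hT0 : 0 ≤ max T 0 := le_max_right _ _
    have hTT : T ≤ max T 0 := le_max_left _ _
    refine le_of_forall_lt_imp_le_of_dense fun B' hB' => hgreatest B' ?_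
    have key := eventually_le_mul_of_deriv_le
      (X := fun t => -(x t * Real.exp (Δ t))) (Y := fun t => xs t * Real.exp (Δ t))
      (X' := fun t => -(Real.exp (Δ t) * N.birth x t))
      (Y' := fun t => Real.exp (Δ t) * N.birth xs t)
      (T := T₀) (B := -min (K + (1 - η - K) * ρ) ((1 - u - ε) * E)) (B' := -B')
      (K := -((1 - u - ε) * E))
      (fun t ht => (hx.hasDerivAt_mul_exp hΔ (by linarith)).neg)
      (fun t ht => hxs.hasDerivAt_mul_exp hΔ (by linarith))
      (fun t ht => mul_nonneg (Real.exp_pos _).le (hxs.birth_nonneg h0 (by linarith)))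
      (tendsto_mul_exp hms (h3.tendsto_primitive hΔint) (hb.mono fun _ h => h.1))
      (neg_le_neg (min_le_right _ _)) (neg_lt_neg hB')
      (fun t ht hlt => by
        have ht0 : 0 ≤ t := by linarith
        have hxs0 : ∀ s, T ≤ s → 0 ≤ xs s := fun s hs => hms.le.trans (hT s hs).1.1.1
        have hfar : ∀ j, x (t - N.σ j t) < (1 - η) * xs (t - N.σ j t) := by
          intro j
          by_contra! hcon
          have hσ := h0.σ_mem ht0 j
          have hmono := le_of_hasDerivAt_nonneg
            (f := fun t => x t * Real.exp (Δ t) - K * (xs t * Real.exp (Δ t)))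
            (f' := fun t => Real.exp (Δ t) * N.birth x t - K * (Real.exp (Δ t) * N.birth xs t))
            hσ.2
            (fun y hy => ((hx.hasDerivAt_mul_exp hΔ (by linarith [hy.1, hσ.1])).sub
              ((hxs.hasDerivAt_mul_exp hΔ (by linarith [hy.1, hσ.1])).const_mul K)
                ).continuousAt.continuousWithinAt)
            (fun y hy => (hx.hasDerivAt_mul_exp hΔ (by linarith [hy.1, hσ.1])).sub
              ((hxs.hasDerivAt_mul_exp hΔ (by linarith [hy.1, hσ.1])).const_mul K))
            (fun y hy => by
              have hTy : T + N.maxDelay ≤ y := by linarith [hy.1, hσ.1]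
              have hy0 : 0 ≤ y := by linarith [hy.1, hσ.1]
              have hbirth := h0.mul_birth_le_birth (x := x) (y := xs) (K := 1 - u - ε)
                (e := -(N.aPlus * Ms * (v + ε))) hy0 (by linarith)
                (fun s hs => hxs0 s (by linarith [hs.1]))
                (fun s hs => (hT s (by linarith [hs.1])).1.2.1) (fun i => by
                  have hi := hT (y - N.σ i y) (by linarith [(h0.σ_mem hy0 i).1])
                  have h6 : x (y - N.σ i y) - xs (y - N.σ i y) ≤ (v + ε) * Ms := by
                    have := mul_le_mul_of_nonneg_left hi.1.1.2 (by linarith : 0 ≤ v + ε)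
                    linarith [hi.1.2.2]
                  have h7 := mul_le_mul_of_nonneg_left h6 (ha.le.trans (h0.le_a hy0 i))
                  have h8 := mul_le_mul_of_nonneg_right (h0.a_le hy0 i)
                    (by positivity : 0 ≤ (v + ε) * Ms)
                  linarith)
              have := mul_le_mul_of_nonneg_left hbirth (Real.exp_pos (Δ y)).le
              linarith)
          have hYs := mul_exp_ge_of_bounds (Δ := Δ) hms hMs
            (hT (t - N.σ j t) (by linarith [hσ.1])).1.1.1 (hT t (by linarith)).1.1.2
            ((hT t (by linarith)).2 j)
          have h7 := mul_le_mul_of_nonneg_left hYs (by linarith : 0 ≤ 1 - η - K)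
          have h8 := mul_le_mul_of_nonneg_right hcon (Real.exp_pos (Δ (t - N.σ j t))).le
          have h9 := mul_le_mul_of_nonneg_right
            (min_le_left (K + (1 - η - K) * ρ) ((1 - u - ε) * E))
            (mul_nonneg (hxs0 t (by linarith)) (Real.exp_pos (Δ t)).le)
          rw [← hρ] at h7
          linarith
        have hbirth := h0.mul_birth_le_birth (x := x) (y := xs) (K := 1 - u - ε)
          (e := N.aMinus * ms * η) ht0 (by linarith)
          (fun s hs => hxs0 s (by linarith [hs.1]))
          (fun s hs => (hT s (by linarith [hs.1])).1.2.1) (fun i => by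
            have hi := hT (t - N.σ i t) (by linarith [(h0.σ_mem ht0 i).1])
            have h6 : η * ms ≤ xs (t - N.σ i t) - x (t - N.σ i t) := by
              have := mul_le_mul_of_nonneg_left hi.1.1.1 hη.le
              linarith [hfar i]
            have h7 := mul_le_mul (h0.le_a ht0 i) h6 (by positivity)
              (ha.le.trans (h0.le_a ht0 i))
            linarith)
        have := mul_le_mul_of_nonneg_left hbirth (Real.exp_pos (Δ t)).le
        linarith)
    filter_upwards [key] with t ht
    exact le_of_mul_le_mul_right (by linarith) (Real.exp_pos (Δ t))
  have step : ∀ η, 0 < η → η < u → -(1 - u) ≤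
      -((1 - u) * Real.exp (-(N.aPlus * Ms * v))
        + (1 - η - (1 - u) * Real.exp (-(N.aPlus * Ms * v)))
          * (ms / Ms * Real.exp (-N.ζPlus))) := by
    intro η hη hηu
    have h4 := le_of_forall_pos_lt_le_of_continuous (by fun_prop) (sub_pos.2 hu1) (main η hη hηu)
    simp only [add_zero, sub_zero] at h4
    rw [neg_le_neg_iff] at h4 ⊢
    rcases min_le_iff.1 h4 with h5 | h5
    · exact h5
    · exfalso
      have : 1 < Real.exp (N.aMinus * ms * η) := Real.one_lt_exp_iff.2 (by positivity)
      nlinarith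
  have h6 := le_of_forall_pos_lt_le_of_continuous (by fun_prop) hu step
  linarith

/-- Global attractivity of a positive solution with suitable eventual bounds. -/
theorem tendsto_sub_of_bounds (h0 : N.A0) (h1 : N.A1) (h2 : N.A2) (h3 : N.A3)
    (hx : N.IsPositiveSolution x) (hxs : N.IsPositiveSolution xs) {ms Ms : ℝ}
    (hms : 0 < ms) (hb : ∀ᶠ t in atTop, ms ≤ xs t ∧ xs t ≤ Ms)
    (h4 : N.aPlus * Ms * (Ms / ms * Real.exp N.ζPlus - 1) ≤ 1) :
    Tendsto (fun t => x t - xs t) atTop (nhds 0) := by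
  have ha := h0.aMinus_pos
  have haP := h0.aPlus_pos
  have hMs : 0 < Ms := by
    obtain ⟨t, ht⟩ := hb.exists
    exact hms.trans_le (ht.1.trans ht.2)
  have hα : 0 < Real.log N.α := Real.log_pos h1.1
  -- Permanence of `x` only serves to make the limits of `x / xs` genuine, with `z₀ > 0` and hence
  -- `u < 1`; any admissible constants do.
  have hlower := hx.eventually_ge h0 h1 h2 h3 (half_pos hα) (half_lt_self hα) (lt_add_one N.D)
  have hupper := hx.eventually_le h0 h1 h2 h3 (lt_add_one (Real.log N.γ)) (lt_add_one N.D)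
    (lt_add_one N.P)
  set l := Real.log N.α / 2 / N.aPlus * Real.exp (-(N.D + 1)) with hl
  have hl0 : 0 < l := by positivity
  set L := (Real.log N.γ + 1) / N.aMinus * Real.exp (N.D + 1 + (N.P + 1)) with hL
  set z : ℝ → ℝ := fun t => x t / xs t with hz
  have hzle : ∀ᶠ t in atTop, z t ≤ L / ms := by
    filter_upwards [hb, hupper, hlower] with t ht ht2 ht3
    exact div_le_div₀ (by linarith) ht2 hms ht.1
  have hzge : ∀ᶠ t in atTop, l / Ms ≤ z t := by
    filter_upwards [hb, hlower] with t ht ht3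
    exact div_le_div₀ (by linarith) ht3 (by linarith) ht.2
  have hbdd : IsBoundedUnder (· ≤ ·) atTop z := ⟨_, eventually_map.2 hzle⟩
  have hbdd' : IsBoundedUnder (· ≥ ·) atTop z := ⟨_, eventually_map.2 hzge⟩
  set Z := limsup z atTop with hZ
  set z₀ := liminf z atTop with hz₀
  have hz₀pos : 0 < z₀ := lt_of_lt_of_le (by positivity)
    (le_liminf_of_le hbdd.isCoboundedUnder_ge hzge)
  -- The ratio may stay on one side of `1`; truncation keeps both deviations nonnegative, and each
  -- limit inequality is needed only where its deviation is positive.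
  set v := max (Z - 1) 0 with hv
  set u := max (1 - z₀) 0 with hu
  have hup : ∀ ε, 0 < ε → ∀ᶠ t in atTop, x t ≤ (1 + v + ε) * xs t := fun ε hε => by
    have : Z < 1 + v + ε := by linarith [le_max_left (Z - 1) 0]
    filter_upwards [eventually_lt_of_limsup_lt this hbdd, hb] with t ht htb
    exact ((div_lt_iff₀ (hms.trans_le htb.1)).1 ht).le
  have hlo : ∀ ε, 0 < ε → ∀ᶠ t in atTop, (1 - u - ε) * xs t ≤ x t := fun ε hε => by
    have : 1 - u - ε < z₀ := by linarith [le_max_left (1 - z₀) 0]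
    filter_upwards [eventually_lt_of_lt_liminf this hbdd', hb] with t ht htb
    exact ((lt_div_iff₀ (hms.trans_le htb.1)).1 ht).le
  have hleast : ∀ B, (∀ᶠ t in atTop, x t ≤ B * xs t) → Z ≤ B := fun B hB => by
    refine limsup_le_of_le hbdd'.isCoboundedUnder_le ?_
    filter_upwards [hB, hb] with t ht htb
    exact (div_le_iff₀ (hms.trans_le htb.1)).2 ht
  have hgreatest : ∀ B, (∀ᶠ t in atTop, B * xs t ≤ x t) → B ≤ z₀ := fun B hB => by
    refine le_liminf_of_le hbdd.isCoboundedUnder_ge ?_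
    filter_upwards [hB, hb] with t ht htb
    exact (le_div_iff₀ (hms.trans_le htb.1)).2 ht
  have hu0 : 0 ≤ u := le_max_right _ _
  have hv0 : 0 ≤ v := le_max_right _ _
  have hρ : (Ms / ms * Real.exp N.ζPlus) * (ms / Ms * Real.exp (-N.ζPlus)) = 1 := by
    rw [Real.exp_neg]
    field_simp
  -- This is (A4) multiplied by `ρ`, the inverse of `(Ms / ms) * exp ζ⁺`.
  have hk : (1 - ms / Ms * Real.exp (-N.ζPlus)) * (1 + N.aPlus * Ms) ≤ 1 := by
    have hρ0 : 0 < ms / Ms * Real.exp (-N.ζPlus) := by positivity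
    have := mul_le_mul_of_nonneg_right h4 hρ0.le
    have e : N.aPlus * Ms * (Ms / ms * Real.exp N.ζPlus - 1) * (ms / Ms * Real.exp (-N.ζPlus))
      = N.aPlus * Ms * ((Ms / ms * Real.exp N.ζPlus) * (ms / Ms * Real.exp (-N.ζPlus)))
        - N.aPlus * Ms * (ms / Ms * Real.exp (-N.ζPlus)) := by ring
    rw [e, hρ] at this
    linarith
  obtain ⟨hu', hv'⟩ := deviations_eq_zero (mul_pos haP hMs) hk hu0 hv0
    (fun hvpos => by
      have hvZ : 1 + v = Z := by
        rcases max_choice (Z - 1) 0 with h | h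
        · rw [hv, h]; ring
        · rw [hv, h] at hvpos; exact absurd hvpos (lt_irrefl _)
      exact upper_limit_inequality h0 h1 h2 h3 hx hxs hms hb hu0 hvpos hlo hup
        (fun B hB => hvZ.le.trans (hleast B hB)))
    (fun hupos => by
      have huz : 1 - u = z₀ := by
        rcases max_choice (1 - z₀) 0 with h | h
        · rw [hu, h]; ring
        · rw [hu, h] at hupos; exact absurd hupos (lt_irrefl _)
      exact lower_limit_inequality h0 h1 h2 h3 hx hxs hms hb hupos (by linarith) hv0 hlo hup
        (fun B hB => (hgreatest B hB).trans huz.ge))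
  rw [Metric.tendsto_nhds]
  intro e he
  have he' : 0 < e / (2 * Ms) := by positivity
  filter_upwards [hup _ he', hlo _ he', hb] with t ht1 ht2 htb
  rw [hv'] at ht1
  rw [hu'] at ht2
  have hsmall : e / (2 * Ms) * xs t < e := by
    have h5 := mul_le_mul_of_nonneg_left htb.2 he'.le
    have h6 : e / (2 * Ms) * Ms = e / 2 := by field_simp
    linarith
  rw [Real.dist_eq, sub_zero, abs_lt]
  constructor <;> linarith

end IsPositiveSolution

/-! ### From (A5) to (A4), and the conclusion -/

/-- Condition (A5) yields bounds for which (A4) holds. -/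
theorem A5.exists_bounds [Nonempty (Fin m)] (h5 : N.A5) (h0 : N.A0) (h1 : N.A1) (h2 : N.A2) :
    ∃ ε, 0 < ε ∧ 0 < Real.log N.α - ε ∧
      N.aPlus * ((Real.log N.γ + ε) / N.aMinus * Real.exp (N.D + ε + (N.P + ε))) *
        ((Real.log N.γ + ε) / N.aMinus * Real.exp (N.D + ε + (N.P + ε)) /
          ((Real.log N.α - ε) / N.aPlus * Real.exp (-(N.D + ε))) * Real.exp N.ζPlus - 1) ≤ 1 := by
  have ha := h0.aMinus_pos
  have haP := h0.aPlus_pos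
  have hα : 0 < Real.log N.α := Real.log_pos h1.1
  have hγ : 0 < Real.log N.γ := Real.log_pos (h1.1.trans_le (h0.α_le_γ h1))
  have hD := h0.D_nonneg h1 h2
  have hP := h0.P_nonneg h2
  set f : ℝ → ℝ := fun ε =>
    N.aPlus * ((Real.log N.γ + ε) / N.aMinus * Real.exp (N.D + ε + (N.P + ε))) *
        ((Real.log N.γ + ε) / N.aMinus * Real.exp (N.D + ε + (N.P + ε)) /
          ((Real.log N.α - ε) / N.aPlus * Real.exp (-(N.D + ε))) * Real.exp N.ζPlus - 1) with hf
  have hcont : ContinuousAt f 0 := by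
    have hne : (Real.log N.α - 0) / N.aPlus * Real.exp (-(N.D + 0)) ≠ 0 := by
      rw [sub_zero]
      positivity
    refine ContinuousAt.mul (by fun_prop) (ContinuousAt.sub (ContinuousAt.mul
      (ContinuousAt.div (by fun_prop) (by fun_prop) hne) (by fun_prop)) (by fun_prop))
  have hf0 : f 0 < 1 := by
    -- The permanence bounds need only the exponents `D + P` and `2 * D + P + ζ⁺`, which (A5)
    -- dominates as `D, P ≥ 0`; strictness at `ε = 0` then leaves room for some `ε > 0`.
    have e : f 0 = (N.aPlus / N.aMinus * Real.log N.γ * Real.exp (N.D + N.P)) *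
        ((N.aPlus * Real.log N.γ) / (N.aMinus * Real.log N.α) *
          Real.exp (2 * N.D + N.P + N.ζPlus) - 1) := by
      have e1 : Real.exp (2 * N.D + N.P + N.ζPlus)
          = Real.exp (N.D + N.P) * Real.exp N.D * Real.exp N.ζPlus := by
        rw [← Real.exp_add, ← Real.exp_add]
        congr 1
        ring
      simp only [hf, add_zero, sub_zero, Real.exp_neg, e1]
      field_simp
    rw [e]
    set c := N.aPlus / N.aMinus * Real.log N.γ with hc
    set b := (N.aPlus * Real.log N.γ) / (N.aMinus * Real.log N.α) with hb
    have hc0 : 0 < c := by positivity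
    have hb0 : 0 < b := by positivity
    have h6 : c * Real.exp (N.D + N.P) ≤ c * Real.exp (2 * (N.D + N.P)) := by
      gcongr
      linarith
    have h7 : b * Real.exp (2 * N.D + N.P + N.ζPlus)
        ≤ b * Real.exp (4 * N.D + 3 * N.P + N.ζPlus) := by
      gcongr
      all_goals linarith
    have hA5 : c * Real.exp (2 * (N.D + N.P)) *
      (b * Real.exp (4 * N.D + 3 * N.P + N.ζPlus) - 1) < 1 := h5
    -- Enlarging the outer factor increases the product only when the bracket is nonnegative.
    rcases le_or_gt (b * Real.exp (2 * N.D + N.P + N.ζPlus) - 1) 0 with h8 | h8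
    · exact (mul_nonpos_of_nonneg_of_nonpos (by positivity) h8).trans_lt one_pos
    · refine lt_of_le_of_lt ?_ hA5
      exact mul_le_mul h6 (by linarith) h8.le (by positivity)
  have hev : ∀ᶠ ε in nhdsWithin (0 : ℝ) (Ioi 0), f ε < 1 :=
    (hcont.eventually (gt_mem_nhds hf0)).filter_mono nhdsWithin_le_nhds
  obtain ⟨ε, hε1, hε2⟩ := (hev.and (Ioo_mem_nhdsGT hα)).exists
  exact ⟨ε, hε2.1, by linarith [hε2.2], hε1.le⟩

end NicholsonData

theorem mainTheorem1 {m : ℕ} (N : NicholsonData m)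
    (h0 : N.A0) (h1 : N.A1) (h2 : N.A2) (h3 : N.A3) :
    (∀ xs : ℝ → ℝ, N.IsPositiveSolution xs → N.A4 xs → N.IsGlobalAttractor xs) ∧
    (N.A5 → ∀ x₁ x₂ : ℝ → ℝ, N.IsPositiveSolution x₁ → N.IsPositiveSolution x₂ →
      Tendsto (fun t => x₁ t - x₂ t) atTop (nhds 0)) := by
  have := h1.nonempty
  refine ⟨fun xs hxs h4 x hx => ?_, fun h5 x₁ x₂ hx₁ hx₂ => ?_⟩
  · obtain ⟨ms, Ms, T, hms, -, -, hb, hle⟩ := h4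
    exact hx.tendsto_sub_of_bounds h0 h1 h2 h3 hxs hms
      ((eventually_ge_atTop (T - N.maxDelay)).mono hb) hle
  · obtain ⟨ε, hε, hαε, hle⟩ := h5.exists_bounds h0 h1 h2
    have haP := h0.aPlus_pos
    exact hx₁.tendsto_sub_of_bounds h0 h1 h2 h3 hx₂ (by positivity)
      ((hx₂.eventually_ge h0 h1 h2 h3 hαε (by linarith) (lt_add_of_pos_right _ hε)).and
        (hx₂.eventually_le h0 h1 h2 h3 (lt_add_of_pos_right _ hε) (lt_add_of_pos_right _ hε)
          (lt_add_of_pos_right _ hε))) hle
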